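/- **Setting.** Let $d,k\in\mathbb N$, $\alpha\in(0,1)$, and let $N\ge 1$ be the natural number with $N\alpha\le 1<(N+1)\alpha$. *Trees and forests.* Forests are finite multisets of (non-planar) rooted trees with nodes decorated by $[d]=\{1,\dots,d\}$; $\mathbb 1$ is the empty forest, the product of forests is concatenation, $[f]_\mu$ is the tree obtained by joining all trees of $f$ to a new root decorated by $\mu$, $|f|$ is the number of nodes and $\#f$ the number of trees of $f$, counted with multiplicity. Let $\mathring{\mathcal T}_{\le j}$ be the set of trees $h$ with $|h|\le j$, $\mathcal T_{\le j}=\mathring{\mathcal T}_{\le j}\cup\{\mathbb 1\}$, let $\mathcal F$ be the set of forests all of whose trees lie in $\mathring{\mathcal T}_{\le N}$, and $\mathcal F_{\le j}=\{f\in\mathcal F:|f|\le j\}$. On the real span of all forests, with its commutative algebra structure, $\langle f,\cdot\rangle$ denotes the $f$-coefficient, $P_{\le j}$ the projection annihilating forests with more than $j$ nodes, and $\Delta$ the coproduct, the linear and multiplicative map with $\Delta\mathbb 1=\mathbb 1\otimes\mathbb 1$ and $\Delta[f]_\mu=[f]_\mu\otimes\mathbb 1+(\mathrm{id}\otimes[\,\cdot\,]_\mu)\Delta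 f$. Fix any total order on $\mathring{\mathcal T}_{\le N-1}$; for $A\subset\mathcal F$ let $\partial A$ be the set of non-empty forests $f\in\mathcal F\setminus A$ containing a tree of $\mathring{\mathcal T}_{\le N-1}$ such that removing from $f$ one instance of the minimal such tree gives an element of $A$. *Paths.* Let $T>0$. A character path assigns to $s,t\in[0,T]$ a unital algebra homomorphism $\mathbf X_{s,t}:\mathrm{Span}(\mathcal F)\to\mathbb R$, whose values are written $\langle\mathbf X_{s,t},f\rangle$ (for instance, $\mathbf X$ may be a branched $\alpha$-rough path). A tree path is a map $\mathbf Y:[0,T]\to\mathrm{Span}(\mathcal T_{\le N-1})^k$; write $Y_s=\langle\mathbb 1,\mathbf Y_s\rangle\in\mathbb R^k$ and $\mathbf Y_s=Y_s\mathbb 1+\delta\mathbf Y_s$. For $g\in C^{N-1}(\mathbb R^k,\mathbb R^k)$ put $$g(\mathbf Y)_s=P_{\le N-1}\sum_{p=0}^{N-1}\frac1{p!}D^pg(Y_s)[\delta\mathbf Y_s,\dots,\delta\mathbf Y_s],$$ where $D^pg(Y_s)[\delta\mathbf Y_s,\dots,\delta\mathbf Y_s]=\sum_{h_1,\dots,h_p\in\mathring{\mathcal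 T}_{\le N-1}}D^pg(Y_s)[\langle h_1,\mathbf Y_s\rangle,\dots,\langle h_p,\mathbf Y_s\rangle]\,h_1\cdots h_p$ (the term $p=0$ is $g(Y_s)\mathbb 1$). For $\mathbf U=\mathbf Y$ or $\mathbf U=g(\mathbf Y)$ the remainders are $$R^{\mathbf U,f}_{s,t}=\langle f,\mathbf U_t\rangle-\langle\mathbf X_{s,t}\otimes f,\Delta\mathbf U_s\rangle\in\mathbb R^k .$$ *Coherence.* Let $\sigma_\mu\in C^N(\mathbb R^k,\mathbb R^k)$ for $\mu\in[d]$. The tree path $\mathbf Y$ is coherent if $\langle f,\sigma_\mu(\mathbf Y)_s\rangle=\langle[f]_\mu,\mathbf Y_s\rangle$ for all $[f]_\mu\in\mathring{\mathcal T}_{\le N-1}$ and all $s\in(0,T]$. The elementary differentials are defined inductively by $\Upsilon_\mu[f]=\Upsilon\big[[f]_\mu\big]=D^{\#f}\sigma_\mu\big[(\Upsilon[h])_{h\in f}\big]$, $\Upsilon_\mu[\mathbb 1]=\sigma_\mu$. Put $$E^{\mathbf Y}_{s,t}=\sum_{h\in\mathring{\mathcal T}_{\le N-1}}\big|\Upsilon[h](Y_s)\langle\mathbf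 X_{s,t},h\rangle\big| .$$ **Statement.** There is a constant $C>0$ depending only on $d,k,\alpha$ such that for every total order on $\mathring{\mathcal T}_{\le N-1}$, all $\sigma_1,\dots,\sigma_d\in C^N(\mathbb R^k,\mathbb R^k)$, every $T>0$, every character path $\mathbf X$, every coherent tree path $\mathbf Y$, every $\mu\in[d]$, every $f\in\mathcal F_{\le N-1}$ and all $s,t\in(0,T]$, $$ \begin{aligned} \big|R^{\sigma_\mu(\mathbf Y),f}_{s,t}\big|\le C\bigg(&\sup\Big\{\big|D\Upsilon_\mu[f](Y_s+a)\big|\cdot\big|R^{\mathbf Y,\mathbb 1}_{s,t}\big| : a\in\mathbb R^k,\ |a|\le E^{\mathbf Y}_{s,t}+|Y_t-Y_s|\Big\}\\ &+\sup\Big\{\Big|D^{\#\tilde f}\Upsilon_\mu[f](Y_s+z)\big[(\Upsilon[h](Y_s))_{h\in\tilde f}\big]\prod_{h\in\tilde f}\langle\mathbf X_{s,t},h\rangle\Big| : \tilde f\in\partial\mathcal F_{\le N-|f|-1},\ z\in\mathbb R^k,\ |z|\le E^{\mathbf Y}_{s,t}\Big\}\bigg), \end{aligned} $$ where the second supremum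 is $0$ if $\partial\mathcal F_{\le N-|f|-1}$ is empty (which happens for $N=1$). Here $|\cdot|$ is the Euclidean norm on $\mathbb R^k$ and, for $D\Upsilon_\mu[f]$, the operator norm. -/

import Mathlib

open scoped TensorProduct

noncomputable section

namespace BranchedRough

/-! ### Decorated rooted trees and forests -/

/-- A root decoration in `[d]` together with a finite collection (with multiplicity, without
order) of elements of `α`. -/
structure NodeShape (d : ℕ) (α : Type) : Type where
  label : Fin d
  kids : Multiset α

instance (d : ℕ) : QPF (NodeShape d) where
  map g x := ⟨x.label, x.kids.map g⟩
  P := ⟨Fin d × ℕ, fun a => Fin a.2⟩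
  abs p := ⟨p.1.1, Multiset.ofList (List.ofFn p.2)⟩
  repr x := ⟨(x.label, x.kids.toList.length), fun i => x.kids.toList.get i⟩
  abs_repr x := by
    obtain ⟨l, k⟩ := x
    change NodeShape.mk l ((List.ofFn (fun i => k.toList.get i) : List _) : Multiset _) = ⟨l, k⟩
    rw [List.ofFn_get, Multiset.coe_toList]
  abs_map g p := by
    change NodeShape.mk p.1.1 ((List.ofFn (g ∘ p.2) : List _) : Multiset _) =
      NodeShape.mk p.1.1 (Multiset.map g (List.ofFn p.2 : List _))
    rw [Multiset.map_coe, List.map_ofFn]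

/-- Non-planar rooted trees with node decorations in `[d]`: the least fixed point (initial
algebra) of `α ↦ [d] × {finite multisets of elements of α}`. -/
def DTree (d : ℕ) : Type := QPF.Fix (NodeShape d)

/-- Forests: finite multisets of trees. The empty forest `𝟙` is `0`, the forest product is `+`,
and the tree `h` seen as a forest is `{h}`. -/
abbrev Forest (d : ℕ) : Type := Multiset (DTree d)

namespace DTree

variable {d : ℕ}

/-- The tree `[f]_μ` obtained by joining all trees of `f` to a new root decorated by `μ`. -/
def node (μ : Fin d) (f : Forest d) : DTree d := QPF.Fix.mk (F := NodeShape d) ⟨μ, f⟩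

/-- The decoration of the root. -/
def root (h : DTree d) : Fin d := (QPF.Fix.dest (F := NodeShape d) h).label

/-- The forest obtained by deleting the root. -/
def children (h : DTree d) : Forest d := (QPF.Fix.dest (F := NodeShape d) h).kids

@[simp] theorem root_node (μ : Fin d) (f : Forest d) : (node μ f).root = μ :=
  congrArg NodeShape.label (QPF.Fix.dest_mk (F := NodeShape d) ⟨μ, f⟩)

@[simp] theorem children_node (μ : Fin d) (f : Forest d) : (node μ f).children = f :=
  congrArg NodeShape.kids (QPF.Fix.dest_mk (F := NodeShape d) ⟨μ, f⟩)

@[simp] theorem node_root_children (h : DTree d) : node h.root h.children = h :=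
  QPF.Fix.mk_dest (F := NodeShape d) h

/-- Structural induction on trees. -/
theorem induct {p : DTree d → Prop}
    (step : ∀ (μ : Fin d) (f : Forest d), (∀ h ∈ f, p h) → p (node μ f)) (h : DTree d) : p h := by
  refine QPF.Fix.ind (F := NodeShape d) p ?_ h
  rintro ⟨μ, f⟩ ⟨⟨ν, g⟩, hg⟩
  refine step μ f ?_
  have h2 : Multiset.map (fun a : {h : DTree d // p h} => a.1) g = f := congrArg NodeShape.kids hg
  intro a ha
  obtain ⟨b, -, hb⟩ := Multiset.mem_map.1 (h2.symm ▸ ha : a ∈ Multiset.map (fun a : {h : DTree d // p h} => a.1) g)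
  exact hb ▸ b.2

/-- The order `|h|`, defined by `|[f]_μ| = 1 + ∑_{h ∈ f} |h|`. -/
def order : DTree d → ℕ :=
  QPF.Fix.rec (F := NodeShape d) (fun x => x.kids.sum + 1)

end DTree

/-- The order `|f| = ∑_{h ∈ f} |h|` of a forest (its number of nodes). -/
def Forest.order {d : ℕ} (f : Forest d) : ℕ := (Multiset.map DTree.order f).sum

namespace DTree

variable {d : ℕ}

theorem order_node (μ : Fin d) (f : Forest d) : (node μ f).order = Forest.order f + 1 :=
  QPF.Fix.rec_eq (F := NodeShape d) (fun x : NodeShape d ℕ => x.kids.sum + 1) ⟨μ, f⟩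

theorem order_eq (h : DTree d) : h.order = Forest.order h.children + 1 := by
  conv_lhs => rw [← node_root_children h]
  rw [order_node]

theorem order_le_of_mem {h : DTree d} {f : Forest d} (hf : h ∈ f) :
    h.order ≤ Forest.order f :=
  Multiset.single_le_sum (fun _ _ => Nat.zero_le _) _ (Multiset.mem_map_of_mem _ hf)

theorem order_lt_of_mem_children {h t : DTree d} (hf : h ∈ t.children) : h.order < t.order := by
  rw [order_eq t]
  exact Nat.lt_succ_of_le (order_le_of_mem hf)

theorem card_le_order (f : Forest d) : Multiset.card f ≤ Forest.order f := by
  induction f using Multiset.induction_on with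
  | empty => simp
  | cons a f ih =>
    have : 1 ≤ a.order := by rw [order_eq]; omega
    simp only [Multiset.card_cons, Forest.order, Multiset.map_cons, Multiset.sum_cons] at ih ⊢
    omega

theorem finite_order_le (d n : ℕ) : {h : DTree d | h.order ≤ n}.Finite := by
  induction n with
  | zero =>
    convert Set.finite_empty
    ext h
    simp [order_eq h]
  | succ n ih =>
    classical
    have hfin : {f : Forest d | Forest.order f ≤ n}.Finite := by
      refine (Multiset.finite_toSet (n • ih.toFinset.val).powerset).subset ?_
      intro f hf
      have hf' : Forest.order f ≤ n := hf
      change f ∈ (n • ih.toFinset.val).powerset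
      rw [Multiset.mem_powerset, Multiset.le_iff_count]
      intro a
      by_cases ha : a ∈ f
      · have h1 : a ∈ ih.toFinset := by
          simpa using (order_le_of_mem ha).trans hf'
        rw [Multiset.count_nsmul, Multiset.count_eq_one_of_mem ih.toFinset.nodup h1, mul_one]
        exact (Multiset.count_le_card a f).trans ((card_le_order f).trans hf')
      · rw [Multiset.count_eq_zero_of_notMem ha]
        exact Nat.zero_le _
    refine ((Set.finite_univ (α := Fin d)).image2 node hfin).subset ?_
    intro h hh
    refine ⟨h.root, Set.mem_univ _, h.children, ?_, node_root_children h⟩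
    have := order_eq h
    simp only [Set.mem_ofPred_eq] at hh ⊢
    omega

/-- The finite set of trees of order at most `n`. -/
def upTo (d n : ℕ) : Finset (DTree d) := (finite_order_le d n).toFinset

@[simp] theorem mem_upTo {n : ℕ} {h : DTree d} : h ∈ upTo d n ↔ h.order ≤ n := by
  simp [upTo]

end DTree

/-! ### The algebra of forests and the coproduct -/

/-- `Span(𝓕_all)`: finite real linear combinations of forests, with the bilinear extension of the
forest product. The inner product `⟨f, a⟩` with a forest `f` is the coefficient `a.coeff f`. -/
abbrev ForestAlg (d : ℕ) : Type := AddMonoidAlgebra ℝ (Forest d)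

variable {d : ℕ}

/-- A forest as a basis element of the algebra of forests. -/
def Forest.basis (f : Forest d) : ForestAlg d := AddMonoidAlgebra.single f 1

/-- Extend a function on forests to a linear map. -/
def linearExt {M : Type*} [AddCommGroup M] [Module ℝ M] (v : Forest d → M) :
    ForestAlg d →ₗ[ℝ] M :=
  Finsupp.linearCombination ℝ v ∘ₗ (AddMonoidAlgebra.coeffLinearEquiv ℝ).toLinearMap

/-- The linear extension of `f ↦ [f]_μ`. -/
def rootLin (μ : Fin d) : ForestAlg d →ₗ[ℝ] ForestAlg d :=
  linearExt (fun f => Forest.basis {DTree.node μ f})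

/-- The linear form `⟨f, ·⟩`. -/
def coeffLin (f : Forest d) : ForestAlg d →ₗ[ℝ] ℝ :=
  Finsupp.lapply f ∘ₗ (AddMonoidAlgebra.coeffLinearEquiv ℝ).toLinearMap

/-- The projection `P_{≤ n}` annihilating the forests of order larger than `n`. -/
def truncate (n : ℕ) : ForestAlg d →ₗ[ℝ] ForestAlg d :=
  linearExt (fun f => if Forest.order f ≤ n then Forest.basis f else 0)

/-- The coproduct of a tree: `Δ[f]_μ = [f]_μ ⊗ 𝟙 + (id ⊗ [·]_μ) Δf`, where
`Δf = ∏_{h ∈ f} Δh`. -/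
def coproductTree : DTree d → ForestAlg d ⊗[ℝ] ForestAlg d
  | h => Forest.basis {h} ⊗ₜ[ℝ] 1 +
      TensorProduct.map LinearMap.id (rootLin h.root)
        ((h.children.attach.map (fun t => coproductTree t.1)).prod)
termination_by h => h.order
decreasing_by exact DTree.order_lt_of_mem_children t.2

/-- The (Connes-Kreimer) coproduct `Δ`, the linear map with `Δf = ∏_{h ∈ f} Δh` for every
forest `f`. -/
def coproduct : ForestAlg d →ₗ[ℝ] ForestAlg d ⊗[ℝ] ForestAlg d :=
  linearExt (fun f => (f.map coproductTree).prod)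

theorem coproductTree_node (μ : Fin d) (f : Forest d) :
    coproductTree (DTree.node μ f) = Forest.basis {DTree.node μ f} ⊗ₜ[ℝ] 1 +
      TensorProduct.map LinearMap.id (rootLin μ) ((f.map coproductTree).prod) := by
  rw [coproductTree]
  simp only [DTree.root_node, Multiset.attach_map_val', DTree.children_node]

/-- `Span(A)` for a set `A` of forests. -/
abbrev spanOf (A : Set (Forest d)) : Submodule ℝ (ForestAlg d) :=
  AddMonoidAlgebra.supported ℝ ℝ A

/-! ### Characters, tree paths, remainders -/

/-- The set `𝓕` of forests all of whose trees have order at most `N`; it is closed under the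
forest product. -/
def forestMonoid (d N : ℕ) : AddSubmonoid (Forest d) where
  carrier := {f | ∀ h ∈ f, h.order ≤ N}
  zero_mem' := by simp
  add_mem' := by
    intro f g hf hg h hh
    rcases Multiset.mem_add.1 hh with h1 | h1
    · exact hf h h1
    · exact hg h h1

/-- `𝓕_{≤ j} = {f ∈ 𝓕 : |f| ≤ j}`. -/
def forestsLE (d N j : ℕ) : Set (Forest d) := {f | f ∈ forestMonoid d N ∧ Forest.order f ≤ j}

/-- `𝒯_{≤ j}`: the trees of order at most `j`, together with `𝟙`. -/
def treesLE (d j : ℕ) : Set (Forest d) := {f | f = 0 ∨ ∃ h : DTree d, h.order ≤ j ∧ f = {h}}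

/-- `Char`: the real characters on `Span(𝓕)`, i.e. the unital algebra homomorphisms
`Span(𝓕) → ℝ`. -/
abbrev Character (d N : ℕ) : Type := AddMonoidAlgebra ℝ (forestMonoid d N) →ₐ[ℝ] ℝ

open Classical in
/-- `⟨u, f⟩` for a character `u` and `f ∈ 𝓕` (and `0` for forests outside of `𝓕`, on which
`u` is not defined). -/
def Character.val {N : ℕ} (u : Character d N) (f : Forest d) : ℝ :=
  if hf : f ∈ forestMonoid d N then u (AddMonoidAlgebra.single ⟨f, hf⟩ 1) else 0

/-- The duality pairing `⟨u, ·⟩`. -/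
def Character.pair {N : ℕ} (u : Character d N) : ForestAlg d →ₗ[ℝ] ℝ := linearExt u.val

/-- `⟨u ⊗ f, a⟩` for a character `u`, a forest `f` and a tensor `a`. -/
def tensorPair {N : ℕ} (u : Character d N) (f : Forest d) :
    ForestAlg d ⊗[ℝ] ForestAlg d →ₗ[ℝ] ℝ :=
  (TensorProduct.lid ℝ ℝ).toLinearMap ∘ₗ TensorProduct.map u.pair (coeffLin f)

/-- A character path `(s,t) ↦ X_{s,t}` on `[0,T]²`. -/
abbrev CharPath (d N : ℕ) (T : ℝ) : Type :=
  Set.Icc (0 : ℝ) T → Set.Icc (0 : ℝ) T → Character d N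

/-- A tree path: a map `[0,T] → Span(𝒯_{≤ N-1})^k`. -/
abbrev TreePath (d k N : ℕ) (T : ℝ) : Type :=
  Set.Icc (0 : ℝ) T → Fin k → spanOf (treesLE d (N - 1))

variable {k : ℕ}

/-- The vector `⟨f, y⟩ ∈ ℝ^k` of `f`-coefficients of `y ∈ Span(𝓕_all)^k`. -/
def coeffVec (y : Fin k → ForestAlg d) (f : Forest d) : EuclideanSpace ℝ (Fin k) :=
  WithLp.toLp 2 (fun i => (y i).coeff f)

/-- The underlying elements of `Span(𝓕_all)^k` of a tree path. -/
def TreePath.toAlg {N : ℕ} {T : ℝ} (Y : TreePath d k N T) :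
    Set.Icc (0 : ℝ) T → Fin k → ForestAlg d :=
  fun s i => (Y s i : ForestAlg d)

/-- The `𝟙`-component `Y_s` of a tree path. -/
def TreePath.base {N : ℕ} {T : ℝ} (Y : TreePath d k N T) (s : Set.Icc (0 : ℝ) T) :
    EuclideanSpace ℝ (Fin k) :=
  coeffVec (Y.toAlg s) 0

/-- The remainder `R^{U,f}_{s,t} = ⟨f, U_t⟩ - ⟨X_{s,t} ⊗ f, Δ U_s⟩` of a tree or forest
path `U`. -/
def remainder {N : ℕ} {T : ℝ} (X : CharPath d N T)
    (U : Set.Icc (0 : ℝ) T → Fin k → ForestAlg d) (f : Forest d) (s t : Set.Icc (0 : ℝ) T) :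
    EuclideanSpace ℝ (Fin k) :=
  coeffVec (U t) f - WithLp.toLp 2 (fun i => tensorPair (X s t) f (coproduct (U s i)))

/-- The composition `g(y)` of `g : ℝ^k → ℝ^k` with `y ∈ Span(𝒯_{≤ N-1})^k`: with
`y = y_0 𝟙 + δy` this is `P_{≤ N-1} ∑_{p=0}^{N-1} (1/p!) D^p g(y_0)[δy, …, δy]`, where
`D^p g(y_0)[δy, …, δy]` stands for
`∑_{h_1, …, h_p} D^p g(y_0)[⟨h_1, y⟩, …, ⟨h_p, y⟩] h_1 ⋯ h_p` with a sum over trees of order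
at most `N-1`. The term `p = 0` is `g(y_0) 𝟙`. -/
def compose (N : ℕ) (g : EuclideanSpace ℝ (Fin k) → EuclideanSpace ℝ (Fin k))
    (y : Fin k → ForestAlg d) : Fin k → ForestAlg d := fun i =>
  truncate (N - 1) (∑ p ∈ Finset.range N, ((p.factorial : ℝ)⁻¹) •
    ∑ h ∈ Fintype.piFinset (fun _ : Fin p => DTree.upTo d (N - 1)),
      (iteratedFDeriv ℝ p g (coeffVec y 0) (fun j => coeffVec y {h j})) i •
        ∏ j, Forest.basis {h j})

/-- The forest path `g(𝐘)`. -/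
def TreePath.comp {N : ℕ} {T : ℝ} (g : EuclideanSpace ℝ (Fin k) → EuclideanSpace ℝ (Fin k))
    (Y : TreePath d k N T) : Set.Icc (0 : ℝ) T → Fin k → ForestAlg d :=
  fun s => compose N g (Y.toAlg s)

/-- Coherence of a tree path: `⟨f, σ_μ(𝐘)_s⟩ = ⟨[f]_μ, 𝐘_s⟩` for all trees `[f]_μ` of order
at most `N-1` and all `s ∈ (0,T]`. -/
def Coherent {N : ℕ} {T : ℝ}
    (σ : Fin d → EuclideanSpace ℝ (Fin k) → EuclideanSpace ℝ (Fin k))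
    (Y : TreePath d k N T) : Prop :=
  ∀ (μ : Fin d) (f : Forest d), (DTree.node μ f).order ≤ N - 1 →
    ∀ s : Set.Icc (0 : ℝ) T, 0 < (s : ℝ) →
      coeffVec (Y.comp (σ μ) s) f = coeffVec (Y.toAlg s) {DTree.node μ f}

/-! ### Elementary differentials -/

/-- `D^p G(x)[v_1, …, v_p]` for a list `v_1, …, v_p` of vectors. -/
def listDeriv (G : EuclideanSpace ℝ (Fin k) → EuclideanSpace ℝ (Fin k))
    (x : EuclideanSpace ℝ (Fin k)) (l : List (EuclideanSpace ℝ (Fin k))) :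
    EuclideanSpace ℝ (Fin k) :=
  iteratedFDeriv ℝ l.length G x l.get

/-- `D^p G(x)[v_1, …, v_p]` for a multiset `{v_1, …, v_p}` of vectors. The enumeration of the
multiset is immaterial, as the `p`-th derivatives of `C^p` functions are symmetric. -/
def multiDeriv (G : EuclideanSpace ℝ (Fin k) → EuclideanSpace ℝ (Fin k))
    (x : EuclideanSpace ℝ (Fin k)) (V : Multiset (EuclideanSpace ℝ (Fin k))) :
    EuclideanSpace ℝ (Fin k) :=
  listDeriv G x V.toList

/-- `Υ[h]` on trees: `Υ[[f]_μ](x) = D^{#f} σ_μ(x)[(Υ[h](x))_{h ∈ f}]`. -/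
def upsilonTree (σ : Fin d → EuclideanSpace ℝ (Fin k) → EuclideanSpace ℝ (Fin k)) :
    DTree d → EuclideanSpace ℝ (Fin k) → EuclideanSpace ℝ (Fin k)
  | h => fun x =>
      multiDeriv (σ h.root) x (h.children.attach.map (fun t => upsilonTree σ t.1 x))
termination_by h => h.order
decreasing_by exact DTree.order_lt_of_mem_children t.2

/-- `Υ_μ[f] = Υ[[f]_μ]` on forests. -/
def upsilon (σ : Fin d → EuclideanSpace ℝ (Fin k) → EuclideanSpace ℝ (Fin k)) (μ : Fin d)
    (f : Forest d) : EuclideanSpace ℝ (Fin k) → EuclideanSpace ℝ (Fin k) :=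
  upsilonTree σ (DTree.node μ f)

theorem upsilon_eq (σ : Fin d → EuclideanSpace ℝ (Fin k) → EuclideanSpace ℝ (Fin k)) (μ : Fin d)
    (f : Forest d) (x : EuclideanSpace ℝ (Fin k)) :
    upsilon σ μ f x = multiDeriv (σ μ) x (f.map (fun t => upsilonTree σ t x)) := by
  unfold upsilon
  rw [upsilonTree, DTree.root_node, DTree.children_node]
  change multiDeriv (σ μ) x (f.attach.map (fun t => upsilonTree σ t.1 x)) = _
  congr 1
  exact Multiset.attach_map_val' f (fun t => upsilonTree σ t x)

/-! ### Boundaries of sets of forests and the expansion bound -/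

/-- The boundary `∂A` of a set `A` of forests, for a total order on the trees of order at most
`N-1`: the nonempty `f ∈ 𝓕 \ A` such that removing from `f` one instance of the minimal tree
`h` of order at most `N-1` appearing in `f` gives an element of `A`. -/
def boundary (N : ℕ) (ord : LinearOrder {h : DTree d // h.order ≤ N - 1})
    (A : Set (Forest d)) : Set (Forest d) :=
  {f | f ∈ forestMonoid d N ∧ f ∉ A ∧ f ≠ 0 ∧
    ∃ (h : {h : DTree d // h.order ≤ N - 1}) (g : Forest d), f = h.1 ::ₘ g ∧ g ∈ A ∧
      ∀ h' : {h : DTree d // h.order ≤ N - 1}, h'.1 ∈ f → ord.le h h'}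

/-- `E^𝐘_{s,t} = ∑_{|h| ≤ N-1} |Υ[h](Y_s) ⟨X_{s,t}, h⟩|`. -/
def expansionBound {N : ℕ} {T : ℝ}
    (σ : Fin d → EuclideanSpace ℝ (Fin k) → EuclideanSpace ℝ (Fin k)) (X : CharPath d N T)
    (Y : TreePath d k N T) (s t : Set.Icc (0 : ℝ) T) : ℝ :=
  ∑ h ∈ DTree.upTo d (N - 1), ‖(X s t).val {h} • upsilonTree σ h (Y.base s)‖

end BranchedRough

end

open scoped TensorProduct

noncomputable section

namespace BranchedRough

/-! ### Symmetric higher derivatives indexed by multisets, and Taylor's formula along a line. -/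

section Calculus

variable {k : ℕ}

local notation "𝔼" => EuclideanSpace ℝ (Fin k)

/-! Write x = Y_s, G = Υ_μ[f], and let B_h (`normDiff`) be Υ[h] divided by the symmetry factor of h.
Coherence determines the path recursively from its base point: ⟨h, Y_s⟩ = B_h(x)
(`coeffVec_singleton_of_coherent`). With the tree series z(ε) = ∑ ε^|h| ⟨X_{s,t}, h⟩ B_h(x), the
𝟙-remainder of Y is therefore Y_t - (x + z(1)) (`remainder_base_eq`), and the f-remainder of σ_μ(Y)
is B_{[f]_μ}(Y_t) - c(1), where c (`cutSeries`) is a polynomial in ε of degree below N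
(`remainder_comp_eq`).

The point is to recognise c(1) as a Taylor polynomial without any combinatorics of cuts. The
parameter ε grades by number of nodes, and two expansions are compared. First, c(ε) = ε^|f|
B_{[f]_μ}(x + z(ε)) + O(ε^N) (`isBigO_cutSeries_sub`), a composition law for B-series: contracting Δ
with a character corresponds to shifting the base point. It is proved by testing against all
characters τ and extracting the coefficient of the monomial of f in τ. Second, expanding G(x + z(ε))
one tree at a time gives a polynomial q of degree at most N - |f| - 1 whose error is controlled by
derivatives indexed by the boundary (`exists_forest_taylor`, from `exists_weighted_taylor`). A
polynomial of degree below N that is O(ε^N) vanishes, so c(1) = θ q(1) with θ the inverse symmetry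
factor of [f]_μ.

The remainder is thus θ (G(Y_t) - q(1)). Inserting G(x + z(1)) splits it into a mean value term,
which produces the first supremum, and the weighted Taylor error at ε = 1, which produces the
second. Inverse symmetry factors lie in [0,1] and can be dropped from all bounds. -/

theorem contDiff_multilinear_apply {V E F : Type*} [NormedAddCommGroup V] [NormedSpace ℝ V]
    [NormedAddCommGroup E] [NormedSpace ℝ E] [NormedAddCommGroup F] [NormedSpace ℝ F]
    {n : WithTop ℕ∞} {p : ℕ} {M : V → ContinuousMultilinearMap ℝ (fun _ : Fin p => E) F}
    {v : Fin p → V → E} (hM : ContDiff ℝ n M) (hv : ∀ i, ContDiff ℝ n (v i)) :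
    ContDiff ℝ n (fun x => M x (fun i => v i x)) := by
  induction p generalizing F with
  | zero =>
    have h : ContDiff ℝ n (fun x => continuousMultilinearCurryFin0 ℝ E F (M x)) :=
      (continuousMultilinearCurryFin0 ℝ E F).contDiff.comp hM
    convert h using 2 with x
    rw [continuousMultilinearCurryFin0_apply]
    congr 1
    exact Subsingleton.elim _ _
  | succ p ih =>
    let L : (E [×(p + 1)]→L[ℝ] F) →L[ℝ] (E →L[ℝ] E [×p]→L[ℝ] F) :=
      (continuousMultilinearCurryLeftEquiv ℝ (fun _ : Fin (p + 1) => E)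
        F).toContinuousLinearEquiv.toContinuousLinearMap
    have hL₀ : ContDiff ℝ n (fun m => L m) := by fun_prop
    have hL : ContDiff ℝ n (fun x => L (M x)) := hL₀.comp hM
    have h1 : ContDiff ℝ n (fun x => L (M x) (v 0 x)) := hL.clm_apply (hv 0)
    have h2 := ih h1 (fun i => hv i.succ)
    convert h2 using 2 with x
    change _ = M x (Fin.cons (v 0 x) fun i => v i.succ x)
    congr 1
    ext i : 1
    refine Fin.cases ?_ (fun j => ?_) i <;> simp

theorem iteratedFDeriv_eq_listDeriv (G : 𝔼 → 𝔼) (x : 𝔼) {p : ℕ} (v : Fin p → 𝔼) :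
    iteratedFDeriv ℝ p G x v = listDeriv G x (List.ofFn v) := by
  have key : ∀ (q : ℕ) (w : Fin q → 𝔼) (h : p = q), (∀ i : Fin p, v i = w (Fin.cast h i)) →
      iteratedFDeriv ℝ p G x v = iteratedFDeriv ℝ q G x w := by
    rintro q w rfl hw
    congr 1
    ext i : 1
    simpa using hw i
  refine key _ _ (List.length_ofFn).symm fun i => ?_
  simp

theorem contDiff_listDeriv {G : 𝔼 → 𝔼} {n : ℕ} {m : WithTop ℕ∞} (hG : ContDiff ℝ n G)
    {ι : Type*} (l : List ι) (v : ι → 𝔼 → 𝔼) (hm : m + l.length ≤ n)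
    (hv : ∀ i ∈ l, ContDiff ℝ m (v i)) :
    ContDiff ℝ m (fun x => listDeriv G x (l.map fun i => v i x)) := by
  have h : (fun x => listDeriv G x (l.map fun i => v i x)) =
      fun x => iteratedFDeriv ℝ l.length G x (fun i => v (l.get i) x) := by
    ext1 x
    rw [iteratedFDeriv_eq_listDeriv]
    congr 1
    apply List.ext_get <;> simp
  rw [h]
  exact contDiff_multilinear_apply (hG.iteratedFDeriv_right hm) fun i => hv _ (l.get_mem i)

theorem listDeriv_nil (G : 𝔼 → 𝔼) (x : 𝔼) : listDeriv G x [] = G x := by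
  simp [listDeriv]

theorem listDeriv_cons {G : 𝔼 → 𝔼} {v : 𝔼} {l : List 𝔼}
    (hG : ContDiff ℝ (l.length + 1 : ℕ) G) (x : 𝔼) :
    listDeriv G x (v :: l) = fderiv ℝ (fun y => listDeriv G y l) x v := by
  have h : DifferentiableAt ℝ (iteratedFDeriv ℝ l.length G) x := by
    refine ((hG.iteratedFDeriv_right (m := 1) ?_).differentiable one_ne_zero) x
    push_cast; rw [add_comm]
  unfold listDeriv
  rw [fderiv_continuousMultilinear_apply_const_apply h]
  exact iteratedFDeriv_succ_apply_left (f := G) (x := x) (v :: l).get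

/-- Adjacent swaps suffice, and swapping the two leading vectors is the symmetry of the second
derivative of the C² function obtained by fixing the others. This makes `multiDeriv` independent of
the enumeration chosen by `Multiset.toList`. -/
theorem listDeriv_perm {G : 𝔼 → 𝔼} {l l' : List 𝔼} (h : l.Perm l')
    (hG : ContDiff ℝ (l.length : ℕ) G) (x : 𝔼) : listDeriv G x l = listDeriv G x l' := by
  induction h generalizing x with
  | nil => rfl
  | cons v h ih =>
    rw [listDeriv_cons (by simpa using hG), listDeriv_cons (by simpa [← h.length_eq] using hG)]
    have := fun y => ih (hG.of_le (by simp)) y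
    simp_rw [this]
  | swap v w l =>
    simp only [List.length_cons] at hG
    have hF : ContDiff ℝ 2 (fun y => listDeriv G y l) := by
      have := contDiff_listDeriv (m := 2) hG l (fun v _ => v) 
        (by push_cast; rw [add_assoc, one_add_one_eq_two, add_comm])
        (fun i _ => contDiff_const)
      simpa using this
    have hG' : ContDiff ℝ (l.length + 1 : ℕ) G := hG.of_le (by norm_cast; omega)
    rw [listDeriv_cons (by simpa using hG), listDeriv_cons (by simpa using hG)]
    simp_rw [listDeriv_cons hG']
    have hd : DifferentiableAt ℝ (fderiv ℝ (fun y => listDeriv G y l)) x :=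
      (hF.fderiv_right (m := 1) (by norm_num [one_add_one_eq_two])).differentiable one_ne_zero x
    have e : ∀ a b : 𝔼, fderiv ℝ (fun y => fderiv ℝ (fun z => listDeriv G z l) y a) x b =
        fderiv ℝ (fderiv ℝ (fun z => listDeriv G z l)) x b a := by
      intro a b
      rw [fderiv_clm_apply hd (differentiableAt_const _)]
      simp
    rw [e, e]
    exact (hF.contDiffAt.isSymmSndFDerivAt (by simp)) w v
  | trans h1 h2 ih1 ih2 => rw [ih1 hG, ih2 (by rwa [← h1.length_eq])]

theorem multiDeriv_coe {G : 𝔼 → 𝔼} {l : List 𝔼} (hG : ContDiff ℝ (l.length : ℕ) G) (x : 𝔼) :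
    multiDeriv G x (l : Multiset 𝔼) = listDeriv G x l := by
  unfold multiDeriv
  have h : (Multiset.toList (l : Multiset 𝔼)).Perm l := Multiset.coe_eq_coe.1 (Multiset.coe_toList _)
  exact listDeriv_perm h (by rwa [h.length_eq]) x

theorem iteratedFDeriv_eq_multiDeriv {G : 𝔼 → 𝔼} {p : ℕ} (hG : ContDiff ℝ p G) (x : 𝔼)
    (v : Fin p → 𝔼) :
    iteratedFDeriv ℝ p G x v = multiDeriv G x (List.ofFn v : List 𝔼) := by
  rw [multiDeriv_coe (by simpa using hG), iteratedFDeriv_eq_listDeriv]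

theorem multiDeriv_zero (G : 𝔼 → 𝔼) (x : 𝔼) : multiDeriv G x 0 = G x := by
  simp [multiDeriv, listDeriv_nil]

theorem multiDeriv_cons {G : 𝔼 → 𝔼} {v : 𝔼} {V : Multiset 𝔼}
    (hG : ContDiff ℝ (Multiset.card V + 1 : ℕ) G) (x : 𝔼) :
    multiDeriv G x (v ::ₘ V) = fderiv ℝ (fun y => multiDeriv G y V) x v := by
  induction V using Quotient.inductionOn with
  | h l =>
    simp only [Multiset.quot_mk_to_coe, Multiset.cons_coe, Multiset.coe_card] at hG ⊢
    rw [multiDeriv_coe (by simpa using hG), listDeriv_cons hG]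
    have := fun y => multiDeriv_coe (l := l) (hG.of_le (by norm_cast; omega)) y
    simp_rw [this]

theorem contDiff_multiDeriv {G : 𝔼 → 𝔼} {n : ℕ} {m : WithTop ℕ∞} (hG : ContDiff ℝ n G)
    {ι : Type*} (f : Multiset ι) (v : ι → 𝔼 → 𝔼) (hm : m + Multiset.card f ≤ n)
    (hv : ∀ i ∈ f, ContDiff ℝ m (v i)) :
    ContDiff ℝ m (fun x => multiDeriv G x (f.map fun i => v i x)) := by
  induction f using Quotient.inductionOn with
  | h l =>
    simp only [Multiset.quot_mk_to_coe, Multiset.coe_card, Multiset.map_coe,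
      Multiset.mem_coe] at hm hv ⊢
    convert contDiff_listDeriv hG l v hm hv using 2 with x
    refine multiDeriv_coe ?_ x
    refine hG.of_le ?_
    rw [List.length_map]
    exact le_trans (by simp) hm

theorem contDiff_multiDeriv_const {G : 𝔼 → 𝔼} {n m : ℕ} (hG : ContDiff ℝ n G)
    (V : Multiset 𝔼) (hm : m + Multiset.card V ≤ n) :
    ContDiff ℝ m (fun x => multiDeriv G x V) := by
  have := contDiff_multiDeriv (m := m) hG V (fun v _ => v) (by exact_mod_cast hm)
    (fun _ _ => contDiff_const)
  simpa using this

/-- Lets the Taylor coefficients in one variable be expanded further in the remaining ones. -/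
theorem multiDeriv_multiDeriv {G : 𝔼 → 𝔼} (V W : Multiset 𝔼)
    (hG : ContDiff ℝ (Multiset.card V + Multiset.card W : ℕ) G) (x : 𝔼) :
    multiDeriv (fun y => multiDeriv G y V) x W = multiDeriv G x (V + W) := by
  induction W using Multiset.induction_on generalizing x with
  | empty => simp [multiDeriv_zero]
  | cons w W ih =>
    rw [Multiset.card_cons] at hG
    rw [multiDeriv_cons (contDiff_multiDeriv_const hG V (by omega)), Multiset.add_cons,
      multiDeriv_cons (by rwa [Multiset.card_add, add_assoc])]
    have := fun y => ih (hG.of_le (by norm_cast; omega)) y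
    simp_rw [this]

theorem multiDeriv_map_smul {G : 𝔼 → 𝔼} {ι : Type*} (f : Multiset ι) (c : ι → ℝ) (v : ι → 𝔼)
    (hG : ContDiff ℝ (Multiset.card f : ℕ) G) (x : 𝔼) :
    multiDeriv G x (f.map fun i => c i • v i) =
      (f.map c).prod • multiDeriv G x (f.map v) := by
  induction f using Multiset.induction_on generalizing x with
  | empty => simp
  | cons i f ih =>
    rw [Multiset.card_cons] at hG
    rw [Multiset.map_cons, Multiset.map_cons, Multiset.map_cons,
      multiDeriv_cons (by simpa using hG), multiDeriv_cons (by simpa using hG)]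
    have := fun y => ih (hG.of_le (by norm_cast; omega)) y
    simp_rw [this]
    have hd : DifferentiableAt ℝ (fun y => multiDeriv G y (f.map v)) x :=
      (contDiff_multiDeriv_const (m := 1) hG (f.map v) (by simp [add_comm])).differentiable
        (by simp) x
    rw [fderiv_fun_const_smul hd, Multiset.prod_cons]
    simp [smul_smul]

theorem multiDeriv_smul_fun {G : 𝔼 → 𝔼} (c : ℝ) (V : Multiset 𝔼)
    (hG : ContDiff ℝ (Multiset.card V : ℕ) G) (x : 𝔼) :
    multiDeriv (fun y => c • G y) x V = c • multiDeriv G x V := by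
  induction V using Multiset.induction_on generalizing x with
  | empty => simp [multiDeriv_zero]
  | cons v V ih =>
    rw [Multiset.card_cons] at hG
    rw [multiDeriv_cons (by exact (contDiff_const (c := c)).smul hG), multiDeriv_cons hG]
    have := fun y => ih (hG.of_le (by norm_cast; omega)) y
    simp_rw [this]
    have hd : DifferentiableAt ℝ (fun y => multiDeriv G y V) x :=
      (contDiff_multiDeriv_const (m := 1) hG V (by simp [add_comm])).differentiable
        (by simp) x
    rw [fderiv_fun_const_smul hd]
    simp

theorem multiDeriv_replicate {G : 𝔼 → 𝔼} (p : ℕ) (hG : ContDiff ℝ p G) (x y : 𝔼) :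
    multiDeriv G x (Multiset.replicate p y) = iteratedFDeriv ℝ p G x (fun _ => y) := by
  rw [iteratedFDeriv_eq_multiDeriv hG, List.ofFn_const, Multiset.coe_replicate]

theorem iteratedDeriv_line {G : 𝔼 → 𝔼} (j : ℕ) (hG : ContDiff ℝ j G) (y w : 𝔼) (t : ℝ) :
    iteratedDeriv j (fun t : ℝ => G (y + t • w)) t =
      multiDeriv G (y + t • w) (Multiset.replicate j w) := by
  induction j generalizing t with
  | zero => simp [multiDeriv_zero]
  | succ j ih =>
    have e : iteratedDeriv j (fun t : ℝ => G (y + t • w)) =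
        fun t => multiDeriv G (y + t • w) (Multiset.replicate j w) :=
      funext fun t => ih (hG.of_le (by norm_cast; omega)) t
    rw [iteratedDeriv_succ, e, Multiset.replicate_succ, multiDeriv_cons (by simpa using hG)]
    have hd : DifferentiableAt ℝ (fun z => multiDeriv G z (Multiset.replicate j w)) (y + t • w) :=
      (contDiff_multiDeriv_const (m := 1) hG _ (by simp [add_comm])).differentiable
        (by simp) _
    have hl : HasDerivAt (fun t : ℝ => y + t • w) w t := by
      simpa using ((hasDerivAt_id t).smul_const w).const_add y
    exact (hd.hasFDerivAt.comp_hasDerivAt t hl).deriv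

/-- Taylor expansion in a fixed direction. -/
theorem norm_sub_taylor_le {G : 𝔼 → 𝔼} (m : ℕ) (hm : 1 ≤ m) (hG : ContDiff ℝ m G) (y w : 𝔼)
    {K t : ℝ} (ht0 : 0 ≤ t)
    (hK : ∀ τ ∈ Set.Icc 0 t, ‖multiDeriv G (y + τ • w) (Multiset.replicate m w)‖ ≤ K) :
    ‖G (y + t • w) - ∑ j ∈ Finset.range m,
      t ^ j • (j.factorial : ℝ)⁻¹ • multiDeriv G y (Multiset.replicate j w)‖ ≤ K * t ^ m := by
  obtain ⟨n, rfl⟩ : ∃ n, m = n + 1 := ⟨m - 1, by omega⟩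
  have hK0 : 0 ≤ K := (norm_nonneg _).trans (hK 0 ⟨le_rfl, ht0⟩)
  -- A one-point interval lacks unique derivatives; at t = 0 only the term j = 0 survives and both
  -- sides vanish.
  rcases ht0.eq_or_lt with rfl | htpos
  · rw [Finset.sum_range_succ']
    simp [multiDeriv_zero]
  have hF : ContDiff ℝ (n + 1 : ℕ) (fun t : ℝ => G (y + t • w)) :=
    hG.comp (contDiff_const.add (contDiff_id.smul contDiff_const))
  have hu : UniqueDiffOn ℝ (Set.Icc 0 t) := uniqueDiffOn_Icc htpos
  have hiter : ∀ j ≤ n + 1, ∀ τ ∈ Set.Icc 0 t,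
      iteratedDerivWithin j (fun t : ℝ => G (y + t • w)) (Set.Icc 0 t) τ =
        multiDeriv G (y + τ • w) (Multiset.replicate j w) := by
    intro j hj τ hτ
    rw [iteratedDerivWithin_eq_iteratedDeriv hu ((hF.of_le (by exact_mod_cast hj)).contDiffAt) hτ,
      iteratedDeriv_line j (hG.of_le (by exact_mod_cast hj))]
  have := taylor_mean_remainder_bound (f := fun t : ℝ => G (y + t • w)) (a := 0) (b := t) (C := K)
    (x := t) (n := n) ht0 (by exact_mod_cast hF.contDiffOn) ⟨ht0, le_rfl⟩
    (fun τ hτ => by rw [hiter _ le_rfl τ hτ]; exact hK τ hτ)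
  have h0 : (0 : ℝ) ∈ Set.Icc 0 t := ⟨le_rfl, ht0⟩
  have e : taylorWithinEval (fun t : ℝ => G (y + t • w)) n (Set.Icc 0 t) 0 t =
      ∑ j ∈ Finset.range (n + 1),
        t ^ j • (j.factorial : ℝ)⁻¹ • multiDeriv G y (Multiset.replicate j w) := by
    rw [taylor_within_apply]
    refine Finset.sum_congr rfl fun j hj => ?_
    rw [hiter j (Finset.mem_range.1 hj).le 0 h0]
    simp [smul_smul, mul_comm]
  rw [e] at this
  refine this.trans ?_
  rw [sub_zero]
  exact div_le_self (by positivity) (by exact_mod_cast Nat.one_le_iff_ne_zero.2 (Nat.factorial_ne_zero n))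

end Calculus

/-! ### Vector-valued polynomials in ε and their uniqueness as asymptotic expansions. -/

section Polynomials

variable {E : Type*} [NormedAddCommGroup E] [NormedSpace ℝ E]

/-- The polynomial functions `ℝ → E` of degree at most `n`. -/
def polyLE (E : Type*) [NormedAddCommGroup E] [NormedSpace ℝ E] (n : ℕ) :
    Submodule ℝ (ℝ → E) :=
  Submodule.span ℝ {q | ∃ j ≤ n, ∃ v : E, q = fun ε => ε ^ j • v}

theorem monomial_mem_polyLE {n j : ℕ} (hj : j ≤ n) (v : E) :
    (fun ε : ℝ => ε ^ j • v) ∈ polyLE E n :=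
  Submodule.subset_span ⟨j, hj, v, rfl⟩

theorem pow_smul_mem_polyLE {n m a : ℕ} {q : ℝ → E} (hq : q ∈ polyLE E n) (h : n + a ≤ m) :
    (fun ε : ℝ => ε ^ a • q ε) ∈ polyLE E m := by
  induction hq using Submodule.span_induction with
  | mem q hq =>
    obtain ⟨j, hj, v, rfl⟩ := hq
    simp only [smul_smul, ← pow_add]
    exact monomial_mem_polyLE (by omega) v
  | zero =>
    convert (polyLE E m).zero_mem using 1
    ext1 ε
    simp
  | add p q _ _ hp hq =>
    convert (polyLE E m).add_mem hp hq using 1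
    ext1 ε
    simp
  | smul c q _ hq =>
    convert (polyLE E m).smul_mem c hq using 1
    ext1 ε
    simp [smul_comm c]

theorem sum_mem_polyLE {ι : Type*} {n : ℕ} (s : Finset ι) (q : ι → ℝ → E)
    (h : ∀ i ∈ s, q i ∈ polyLE E n) : (fun ε => ∑ i ∈ s, q i ε) ∈ polyLE E n := by
  convert (polyLE E n).sum_mem h using 1
  ext1 ε
  simp

theorem exists_coeff_of_mem_polyLE {n : ℕ} {q : ℝ → E} (hq : q ∈ polyLE E n) :
    ∃ c : ℕ → E, ∀ ε, q ε = ∑ j ∈ Finset.range (n + 1), ε ^ j • c j := by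
  induction hq using Submodule.span_induction with
  | mem q hq =>
    obtain ⟨j, hj, v, rfl⟩ := hq
    refine ⟨fun i => if i = j then v else 0, fun ε => ?_⟩
    simp [Nat.lt_succ_of_le hj]
  | zero => exact ⟨0, by simp⟩
  | add p q _ _ hp hq =>
    obtain ⟨c, hc⟩ := hp
    obtain ⟨c', hc'⟩ := hq
    exact ⟨c + c', fun ε => by simp [hc, hc', Finset.sum_add_distrib]⟩
  | smul a q _ hq =>
    obtain ⟨c, hc⟩ := hq
    exact ⟨a • c, fun ε => by simp [hc, Finset.smul_sum, smul_comm a]⟩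

open Filter Topology Asymptotics

/-- Letting ε tend to 0 kills the constant coefficient; divide by ε and induct. -/
theorem coeff_eq_zero_of_isBigO (n : ℕ) (c : ℕ → E)
    (h : (fun ε : ℝ => ∑ j ∈ Finset.range n, ε ^ j • c j) =O[𝓝[>] 0] fun ε => ε ^ n) :
    ∀ j < n, c j = 0 := by
  induction n generalizing c with
  | zero => intro j hj; omega
  | succ n ih =>
    have h0 : c 0 = 0 := by
      have h1 : Tendsto (fun ε : ℝ => ∑ j ∈ Finset.range (n + 1), ε ^ j • c j) (𝓝[>] 0) (𝓝 0) := by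
        refine h.trans_tendsto ?_
        have : Tendsto (fun ε : ℝ => ε ^ (n + 1)) (𝓝 0) (𝓝 (0 ^ (n + 1))) :=
          (continuous_pow _).tendsto 0
        rw [zero_pow (by omega)] at this
        exact this.mono_left nhdsWithin_le_nhds
      have h2 : Tendsto (fun ε : ℝ => ∑ j ∈ Finset.range (n + 1), ε ^ j • c j) (𝓝 0)
          (𝓝 (∑ j ∈ Finset.range (n + 1), (0 : ℝ) ^ j • c j)) := by
        have : Continuous (fun ε : ℝ => ∑ j ∈ Finset.range (n + 1), ε ^ j • c j) := by fun_prop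
        exact this.tendsto 0
      have h3 := tendsto_nhds_unique (h2.mono_left nhdsWithin_le_nhds) h1
      rw [Finset.sum_range_succ'] at h3
      simpa using h3
    have h1 : ∀ j < n, c (j + 1) = 0 := by
      refine ih (fun j => c (j + 1)) ?_
      have h2 : (fun ε : ℝ => ε⁻¹ • ∑ j ∈ Finset.range (n + 1), ε ^ j • c j) =O[𝓝[>] 0]
          fun ε => ε⁻¹ • ε ^ (n + 1) := (isBigO_refl (fun ε : ℝ => ε⁻¹) _).smul h
      refine h2.congr' ?_ ?_
      · filter_upwards [self_mem_nhdsWithin] with ε hε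
        have hε' : ε ≠ 0 := (Set.mem_Ioi.1 hε).ne'
        rw [Finset.sum_range_succ', h0, smul_zero, add_zero, Finset.smul_sum]
        refine Finset.sum_congr rfl fun j _ => ?_
        rw [smul_smul, pow_succ', inv_mul_cancel_left₀ hε']
      · filter_upwards [self_mem_nhdsWithin] with ε hε
        have hε' : ε ≠ 0 := (Set.mem_Ioi.1 hε).ne'
        rw [smul_eq_mul, pow_succ', inv_mul_cancel_left₀ hε']
    rintro (_ | j) hj
    · exact h0
    · exact h1 j (by omega)

theorem eq_zero_of_mem_polyLE_of_isBigO {n : ℕ} {q : ℝ → E} (hq : q ∈ polyLE E n)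
    (h : q =O[𝓝[>] 0] fun ε : ℝ => ε ^ (n + 1)) : q = 0 := by
  obtain ⟨c, hc⟩ := exists_coeff_of_mem_polyLE hq
  have hz := coeff_eq_zero_of_isBigO (n + 1) c (by simpa only [← hc] using h)
  ext1 ε
  rw [hc]
  exact Finset.sum_eq_zero fun j hj => by rw [hz j (Finset.mem_range.1 hj), smul_zero]

end Polynomials

/-! ### Weighted Taylor expansion in several directions. -/

section AnisotropicTaylor

variable {k : ℕ}

local notation "𝔼" => EuclideanSpace ℝ (Fin k)

theorem card_le_sum_weight {ι : Type*} {ω : ι → ℕ} (hω : ∀ i, 1 ≤ ω i) (g : Multiset ι) :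
    Multiset.card g ≤ (g.map ω).sum := by
  induction g using Multiset.induction_on with
  | empty => simp
  | cons i g ih => have := hω i; simp; omega

theorem norm_sum_pow_smul_le {ι : Type*} {ω : ι → ℕ} (w : ι → 𝔼) {ε : ℝ} (hε : ε ∈ Set.Icc (0 : ℝ) 1)
    (L : List ι) :
    ‖(L.map fun i => ε ^ ω i • w i).sum‖ ≤ (L.map fun i => ‖w i‖).sum := by
  induction L with
  | nil => simp
  | cons i L ih =>
    simp only [List.map_cons, List.sum_cons]
    refine (norm_add_le _ _).trans (add_le_add ?_ ih)
    rw [norm_smul, norm_pow, Real.norm_of_nonneg hε.1]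
    exact mul_le_of_le_one_left (norm_nonneg _) (pow_le_one₀ hε.1 hε.2)

/-- Weighted Taylor expansion: the variables are expanded one after the other, starting with the
head of the list, and the error is controlled by the derivatives indexed by the multisets
`i ::ₘ g` of weight larger than `n` for which `i` is minimal and `g` has weight at most `n`. -/
theorem exists_weighted_taylor {ι : Type*} {ω : ι → ℕ} (hω : ∀ i, 1 ≤ ω i) (w : ι → 𝔼) (x : 𝔼)
    {r : ι → ι → Prop} {K ρ : ℝ} (hK0 : 0 ≤ K) (L : List ι) (hL : L.Pairwise r)
    (hρ : (L.map fun i => ‖w i‖).sum ≤ ρ) (n : ℕ) (G : 𝔼 → 𝔼) (hG : ContDiff ℝ (n + 1 : ℕ) G)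
    (hK : ∀ i ∈ L, ∀ g : Multiset ι, (∀ j ∈ g, j ∈ L ∧ (j = i ∨ r j i)) →
      (g.map ω).sum ≤ n → n < (g.map ω).sum + ω i → ∀ z : 𝔼, ‖z‖ ≤ ρ →
      ‖multiDeriv G (x + z) ((i ::ₘ g).map w)‖ ≤ K) :
    ∃ q ∈ polyLE 𝔼 n, ∀ ε ∈ Set.Icc (0 : ℝ) 1,
      ‖G (x + (L.map fun i => ε ^ ω i • w i).sum) - q ε‖ ≤
        (n + 2 : ℝ) ^ L.length * K * ε ^ (n + 1) := by
  induction L generalizing n G with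
  | nil =>
    refine ⟨fun ε => G x, by simpa using monomial_mem_polyLE (Nat.zero_le n) (G x), ?_⟩
    intro ε hε
    have := hε.1
    simp only [List.map_nil, List.sum_nil, add_zero, sub_self, norm_zero, List.length_nil]
    positivity
  | cons i L ih =>
    rw [List.pairwise_cons] at hL
    simp only [List.map_cons, List.sum_cons] at hρ
    have hwi := norm_nonneg (w i)
    -- The least number of copies of `i` whose total weight exceeds n.
    set m := n / ω i + 1 with hm
    have hm1 : 1 ≤ m := by rw [hm]; exact Nat.succ_le_succ (Nat.zero_le _)
    have hωi : 0 < ω i := hω i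
    have hmn : n < m * ω i := by
      rw [hm, add_mul, one_mul]; exact Nat.lt_div_mul_add hωi
    have hjn : ∀ j < m, j * ω i ≤ n := fun j hj =>
      (Nat.mul_le_mul_right _ (Nat.lt_succ_iff.1 hj)).trans (Nat.div_mul_le_self n _)
    have hjω : ∀ j, j ≤ j * ω i := fun j => Nat.le_mul_of_pos_right j hωi
    have hmn1 : m ≤ n + 1 := by rw [hm]; exact Nat.succ_le_succ (Nat.div_le_self _ _)
    -- Taylor coefficients in the direction `w i`, as functions of the point that carries the
    -- remaining variables. The induction expands the j-th one up to the unused weight n - j ω_i;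
    -- enough derivatives are left because j ≤ j ω_i.
    let H : ℕ → 𝔼 → 𝔼 := fun j y =>
      (j.factorial : ℝ)⁻¹ • multiDeriv G y (Multiset.replicate j (w i))
    have hex : ∀ j, ∃ q : ℝ → 𝔼, j < m → q ∈ polyLE 𝔼 (n - j * ω i) ∧ ∀ ε ∈ Set.Icc (0 : ℝ) 1,
        ‖H j (x + (L.map fun i => ε ^ ω i • w i).sum) - q ε‖ ≤
        ((n - j * ω i : ℕ) + 2 : ℝ) ^ L.length * K * ε ^ (n - j * ω i + 1) := by
      intro j
      by_cases hj : j < m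
      swap
      · exact ⟨0, fun h => absurd h hj⟩
      have h1 := hjn j hj
      have h2 := hjω j
      have hD : ContDiff ℝ (n - j * ω i + 1 : ℕ)
          (fun y => multiDeriv G y (Multiset.replicate j (w i))) :=
        contDiff_multiDeriv_const hG _ (by rw [Multiset.card_replicate]; omega)
      obtain ⟨q, hq, hb⟩ := ih hL.2 (by linarith) (n - j * ω i) (H j)
        (by exact (contDiff_const (c := (j.factorial : ℝ)⁻¹)).smul hD) (by
          intro i' hi' g hg hgn hgn' z hz
          have hc := card_le_sum_weight hω g
          change ‖multiDeriv (fun y => (j.factorial : ℝ)⁻¹ •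
            multiDeriv G y (Multiset.replicate j (w i))) (x + z) _‖ ≤ K
          rw [multiDeriv_smul_fun _ _ (hD.of_le (by
              rw [Multiset.card_map, Multiset.card_cons]; norm_cast; omega)),
            multiDeriv_multiDeriv _ _ (hG.of_le (by
              rw [Multiset.card_map, Multiset.card_cons, Multiset.card_replicate]
              norm_cast; omega))]
          have e : Multiset.replicate j (w i) + (i' ::ₘ g).map w =
              (i' ::ₘ (g + Multiset.replicate j i)).map w := by
            simp [add_comm]
          rw [e, norm_smul]
          -- The j copies of the earlier variable `i` are related by `r` to `i'`, so `i'` stays the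
          -- distinguished element of the enlarged multiset.
          have hb := hK i' (List.mem_cons_of_mem _ hi') (g + Multiset.replicate j i) (by
            intro j' hj'
            rcases Multiset.mem_add.1 hj' with h | h
            · exact ⟨List.mem_cons_of_mem _ (hg j' h).1, (hg j' h).2⟩
            · rw [Multiset.eq_of_mem_replicate h]
              exact ⟨List.mem_cons_self, Or.inr (hL.1 i' hi')⟩)
            (by simp; omega) (by simp; omega) z hz
          refine (mul_le_of_le_one_left (norm_nonneg _) ?_).trans hb
          rw [norm_inv, Real.norm_natCast]
          exact inv_le_one_of_one_le₀ (by exact_mod_cast Nat.factorial_pos j))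
      exact ⟨q, fun _ => ⟨hq, hb⟩⟩
    choose q hq using hex
    refine ⟨fun ε => ∑ j ∈ Finset.range m, ε ^ (j * ω i) • q j ε, ?_, ?_⟩
    · refine sum_mem_polyLE _ _ fun j hj => ?_
      have := hjn j (Finset.mem_range.1 hj)
      exact pow_smul_mem_polyLE (hq j (Finset.mem_range.1 hj)).1 (by omega)
    intro ε hε
    have hε0 := hε.1
    set y := x + (L.map fun i => ε ^ ω i • w i).sum with hy
    have hT := norm_sub_taylor_le m (by omega) (hG.of_le (by exact_mod_cast hmn1)) y (w i)
      (K := K) (t := ε ^ ω i) (by positivity) (by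
        intro τ hτ
        have hτ1 : τ ≤ 1 := hτ.2.trans (pow_le_one₀ hε.1 hε.2)
        -- The error in the direction `w i` involves m copies of `i`: removing one brings the weight
        -- down to at most n, by minimality of m.
        have hb := hK i List.mem_cons_self (Multiset.replicate (m - 1) i) (by
          intro j hj
          rw [Multiset.eq_of_mem_replicate hj]
          exact ⟨List.mem_cons_self, Or.inl rfl⟩)
          (by simpa using hjn (m - 1) (by omega))
          (by
            have : (m - 1) * ω i + ω i = m * ω i := by rw [hm]; simp [add_mul]
            simp; omega)
          ((L.map fun i => ε ^ ω i • w i).sum + τ • w i) (by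
            refine (norm_add_le _ _).trans ?_
            have h1 := norm_sum_pow_smul_le (ω := ω) w hε L
            have h2 : ‖τ • w i‖ ≤ ‖w i‖ := by
              rw [norm_smul, Real.norm_of_nonneg hτ.1]
              exact mul_le_of_le_one_left hwi hτ1
            linarith)
        rw [← add_assoc, ← hy, ← Multiset.replicate_succ, Multiset.map_replicate] at hb
        exact hb)
    have hsplit : G (x + (List.map (fun i => ε ^ ω i • w i) (i :: L)).sum) -
        ∑ j ∈ Finset.range m, ε ^ (j * ω i) • q j ε =
        (G (y + ε ^ ω i • w i) - ∑ j ∈ Finset.range m, (ε ^ ω i) ^ j • (j.factorial : ℝ)⁻¹ •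
          multiDeriv G y (Multiset.replicate j (w i))) +
        ∑ j ∈ Finset.range m, ε ^ (j * ω i) • (H j y - q j ε) := by
      have e1 : x + (List.map (fun i => ε ^ ω i • w i) (i :: L)).sum = y + ε ^ ω i • w i := by
        rw [hy, List.map_cons, List.sum_cons]; abel
      have e2 : ∀ j, (ε ^ ω i) ^ j = ε ^ (j * ω i) := fun j => by rw [← pow_mul, mul_comm]
      simp only [e1, e2, smul_sub, Finset.sum_sub_distrib, H]
      abel
    rw [hsplit]
    have hA : K * (ε ^ ω i) ^ m ≤ K * ε ^ (n + 1) := by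
      refine mul_le_mul_of_nonneg_left ?_ hK0
      rw [← pow_mul, mul_comm]
      exact pow_le_pow_of_le_one hε.1 hε.2 hmn
    have hB : ‖∑ j ∈ Finset.range m, ε ^ (j * ω i) • (H j y - q j ε)‖ ≤
        (n + 1 : ℝ) * ((n + 2 : ℝ) ^ L.length * K * ε ^ (n + 1)) := by
      have hterm : ∀ j ∈ Finset.range m, ‖ε ^ (j * ω i) • (H j y - q j ε)‖ ≤
          (n + 2 : ℝ) ^ L.length * K * ε ^ (n + 1) := by
        intro j hj
        have hj' := Finset.mem_range.1 hj
        have h1 := hjn j hj'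
        rw [norm_smul, norm_pow, Real.norm_of_nonneg hε0]
        have hb := (hq j hj').2 ε hε
        calc ε ^ (j * ω i) * ‖H j y - q j ε‖
            ≤ ε ^ (j * ω i) * (((n - j * ω i : ℕ) + 2 : ℝ) ^ L.length * K *
              ε ^ (n - j * ω i + 1)) := by gcongr
          _ = ((n - j * ω i : ℕ) + 2 : ℝ) ^ L.length * K * ε ^ (n + 1) := by
              have : n + 1 = j * ω i + (n - j * ω i + 1) := by omega
              conv_rhs => rw [this, pow_add]
              ring
          _ ≤ _ := by
              gcongr
              omega
      refine (norm_sum_le_of_le _ hterm).trans ?_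
      rw [Finset.sum_const, Finset.card_range, nsmul_eq_mul]
      gcongr
      exact_mod_cast hmn1
    refine (norm_add_le _ _).trans ((add_le_add (hT.trans hA) hB).trans ?_)
    -- The constants combine as 1 + (n+1)(n+2)^l ≤ (n+2)^(l+1), with l the length of `L`.
    have h1 : (1 : ℝ) ≤ (n + 2 : ℝ) ^ L.length := one_le_pow₀ (by linarith [Nat.cast_nonneg (α := ℝ) n])
    have h2 : 0 ≤ K * ε ^ (n + 1) := by positivity
    rw [List.length_cons, pow_succ (n + 2 : ℝ)]
    linarith [mul_le_mul_of_nonneg_right h1 h2]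

end AnisotropicTaylor

/-! ### Characters, contraction of the coproduct, and convolution. -/

section Algebra

variable {d N : ℕ}

theorem linearExt_basis {M : Type*} [AddCommGroup M] [Module ℝ M] (v : Forest d → M)
    (f : Forest d) : linearExt v (Forest.basis f) = v f := by
  simp [linearExt, Forest.basis]

theorem linearExt_eq_sum {M : Type*} [AddCommGroup M] [Module ℝ M] (v : Forest d → M)
    (a : ForestAlg d) {F : Finset (Forest d)} (h : ∀ f, a.coeff f ≠ 0 → v f ≠ 0 → f ∈ F) :
    linearExt v a = ∑ f ∈ F, a.coeff f • v f := by
  classical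
  have h1 : linearExt v a = ∑ f ∈ a.coeff.support, a.coeff f • v f := by
    simp only [linearExt, LinearMap.comp_apply, Finsupp.linearCombination_apply]
    rfl
  rw [h1]
  refine Finset.sum_congr_of_eq_on_inter ?_ ?_ fun _ _ _ => rfl
  · intro f hf hF
    by_contra h0
    exact hF (h f (Finsupp.mem_support_iff.1 hf) (right_ne_zero_of_smul h0))
  · intro f _ hf
    rw [Finsupp.notMem_support_iff.1 hf, zero_smul]

theorem forestAlg_hom_ext {M : Type*} [AddCommGroup M] [Module ℝ M] {A B : ForestAlg d →ₗ[ℝ] M}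
    (h : ∀ f : Forest d, A (Forest.basis f) = B (Forest.basis f)) : A = B := by
  refine AddMonoidAlgebra.lhom_ext' fun f => ?_
  ext
  exact h f

theorem basis_add (f g : Forest d) : Forest.basis (f + g) = Forest.basis f * Forest.basis g := by
  simp [Forest.basis, AddMonoidAlgebra.single_mul_single]

theorem basis_zero : Forest.basis (0 : Forest d) = 1 := rfl

theorem coeffLin_basis (f g : Forest d) [Decidable (g = f)] :
    (Forest.basis g).coeff f = if g = f then 1 else 0 := by
  classical
  simp [Forest.basis, Finsupp.single_apply]

/-- The character of the algebra of forests with prescribed values on trees. -/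
def evalAlg (τ : DTree d → ℝ) : ForestAlg d →ₐ[ℝ] ℝ :=
  AddMonoidAlgebra.lift ℝ ℝ (Forest d)
    { toFun := fun f => (Multiset.map τ f.toAdd).prod
      map_one' := by simp
      map_mul' := by simp }

theorem evalAlg_basis (τ : DTree d → ℝ) (f : Forest d) :
    evalAlg τ (Forest.basis f) = (f.map τ).prod := by
  simp only [evalAlg, Forest.basis, AddMonoidAlgebra.lift_single, one_smul]
  rfl

theorem evalAlg_eq_linearExt (τ : DTree d → ℝ) :
    (evalAlg τ).toLinearMap = linearExt fun f => (f.map τ).prod :=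
  forestAlg_hom_ext fun f => by
    rw [linearExt_basis]; exact evalAlg_basis τ f

theorem Character.val_zero (u : Character d N) : u.val 0 = 1 := by
  have h : (0 : Forest d) ∈ forestMonoid d N := zero_mem _
  rw [Character.val, dif_pos h]
  exact map_one u

/-- The default value 0 outside 𝓕 respects products, since a forest lies in 𝓕 exactly when each of
its trees does. Hence `u` extends to a character of the algebra of all forests. -/
theorem Character.val_cons (u : Character d N) (h : DTree d) (f : Forest d) :
    u.val (h ::ₘ f) = u.val {h} * u.val f := by
  by_cases h1 : ({h} : Forest d) ∈ forestMonoid d N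
  · by_cases h2 : f ∈ forestMonoid d N
    · have h3 : h ::ₘ f ∈ forestMonoid d N := by
        rw [← Multiset.singleton_add]; exact add_mem h1 h2
      rw [Character.val, Character.val, Character.val, dif_pos h1, dif_pos h2, dif_pos h3,
        ← map_mul, AddMonoidAlgebra.single_mul_single, mul_one]
      rfl
    · have h3 : h ::ₘ f ∉ forestMonoid d N := fun h3 =>
        h2 fun t ht => h3 t (Multiset.mem_cons_of_mem ht)
      rw [Character.val, dif_neg h3, Character.val, Character.val, dif_neg h2, mul_zero]
  · have h3 : h ::ₘ f ∉ forestMonoid d N := fun h3 =>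
      h1 fun t ht => h3 t (by rw [Multiset.mem_singleton.1 ht]; exact Multiset.mem_cons_self _ _)
    rw [Character.val, dif_neg h3, Character.val, dif_neg h1, zero_mul]

theorem Character.val_eq_prod (u : Character d N) (f : Forest d) :
    u.val f = (f.map fun h => u.val {h}).prod := by
  induction f using Multiset.induction_on with
  | empty => simpa using u.val_zero
  | cons h f ih => rw [u.val_cons, ih, Multiset.map_cons, Multiset.prod_cons]

theorem Character.pair_eq (u : Character d N) :
    u.pair = (evalAlg fun h => u.val {h}).toLinearMap :=
  forestAlg_hom_ext fun f => by
    rw [Character.pair, linearExt_basis, u.val_eq_prod]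
    exact (evalAlg_basis _ f).symm

/-- The contraction `u ⊗ id` of the left tensor factor with a character. -/
def slice (u : Character d N) : ForestAlg d ⊗[ℝ] ForestAlg d →ₗ[ℝ] ForestAlg d :=
  (TensorProduct.lid ℝ (ForestAlg d)).toLinearMap ∘ₗ TensorProduct.map u.pair LinearMap.id

theorem slice_tmul (u : Character d N) (a b : ForestAlg d) :
    slice u (a ⊗ₜ b) = u.pair a • b := by
  simp [slice]

theorem tensorPair_eq (u : Character d N) (f : Forest d) (a : ForestAlg d ⊗[ℝ] ForestAlg d) :
    tensorPair u f a = (slice u a).coeff f := by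
  change tensorPair u f a = coeffLin f (slice u a)
  induction a using TensorProduct.induction_on with
  | zero => simp
  | tmul a b => simp [tensorPair, slice_tmul]
  | add a b ha hb => simp only [map_add, ha, hb]

theorem slice_map_rootLin (u : Character d N) (ν : Fin d) (a : ForestAlg d ⊗[ℝ] ForestAlg d) :
    slice u (TensorProduct.map LinearMap.id (rootLin ν) a) = rootLin ν (slice u a) := by
  induction a using TensorProduct.induction_on with
  | zero => simp
  | tmul a b => simp [slice_tmul]
  | add a b ha hb => simp only [map_add, ha, hb]

/-- The contraction `(u ⊗ id) Δ f` for a forest `f`. -/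
def cut (u : Character d N) (f : Forest d) : ForestAlg d := slice u ((f.map coproductTree).prod)

theorem slice_coproduct_basis (u : Character d N) (f : Forest d) :
    slice u (coproduct (Forest.basis f)) = cut u f := by
  rw [coproduct, linearExt_basis, cut]

theorem cut_zero (u : Character d N) : cut u 0 = 1 := by
  rw [cut, Multiset.map_zero, Multiset.prod_zero, Algebra.TensorProduct.one_def, slice_tmul,
    ← basis_zero, Character.pair, linearExt_basis, u.val_zero, one_smul]

theorem cut_singleton_node (u : Character d N) (ν : Fin d) (g : Forest d) :
    cut u {DTree.node ν g} = u.val {DTree.node ν g} • 1 + rootLin ν (cut u g) := by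
  rw [cut, Multiset.map_singleton, Multiset.prod_singleton, coproductTree_node, map_add,
    slice_map_rootLin, slice_tmul, Character.pair, linearExt_basis, cut]

theorem coeff_zero_rootLin (ν : Fin d) (a : ForestAlg d) : (rootLin ν a).coeff 0 = 0 := by
  classical
  change (coeffLin 0 ∘ₗ rootLin ν) a = (0 : ForestAlg d →ₗ[ℝ] ℝ) a
  congr 1
  refine forestAlg_hom_ext fun f => ?_
  rw [LinearMap.comp_apply, rootLin, linearExt_basis]
  change (Forest.basis _).coeff 0 = 0
  rw [coeffLin_basis, if_neg (Multiset.singleton_ne_zero _)]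

theorem coeff_zero_cut_zero (u : Character d N) : (cut u 0).coeff 0 = 1 := by
  classical
  rw [cut_zero, ← basis_zero, coeffLin_basis, if_pos rfl]

/-- Every term produced by regrafting the root is a nonempty forest, so only h ⊗ 𝟙 contributes. -/
theorem coeff_zero_cut_singleton (u : Character d N) (h : DTree d) :
    (cut u {h}).coeff 0 = u.val {h} := by
  classical
  conv_lhs => rw [← h.node_root_children, cut_singleton_node]
  rw [AddMonoidAlgebra.coeff_add, Finsupp.add_apply, coeff_zero_rootLin, add_zero,
    AddMonoidAlgebra.coeff_smul, Finsupp.smul_apply, ← basis_zero, coeffLin_basis, if_pos rfl,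
    smul_eq_mul, mul_one, h.node_root_children]

/-- The values on trees of the convolution of two characters. -/
def conv (u : Character d N) (τ : DTree d → ℝ) (h : DTree d) : ℝ := evalAlg τ (cut u {h})

/-- Δ is multiplicative, and u ⊗ τ followed by multiplication is an algebra homomorphism. -/
theorem evalAlg_cut (u : Character d N) (τ : DTree d → ℝ) (f : Forest d) :
    evalAlg τ (cut u f) = (f.map (conv u τ)).prod := by
  let Φ : ForestAlg d ⊗[ℝ] ForestAlg d →ₐ[ℝ] ℝ :=
    (Algebra.TensorProduct.lmul' ℝ).comp
      (Algebra.TensorProduct.map (evalAlg fun h => u.val {h}) (evalAlg τ))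
  have hΦ : ∀ a, evalAlg τ (slice u a) = Φ a := by
    intro a
    induction a using TensorProduct.induction_on with
    | zero => simp
    | tmul a b =>
      rw [slice_tmul, u.pair_eq]
      simp [Φ]
    | add a b ha hb => simp only [map_add, ha, hb]
  have hconv : ∀ h, conv u τ h = Φ (coproductTree h) := fun h => by
    rw [conv, cut, hΦ, Multiset.map_singleton, Multiset.prod_singleton]
  rw [cut, hΦ, map_multiset_prod, Multiset.map_map]
  congr 1
  exact Multiset.map_congr rfl fun h _ => (hconv h).symm

/-- Either the whole tree goes to `u`, or its root goes to `τ`. The second part is linear in the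
tree values of `τ`, with the coefficients of the contracted coproduct of `g`; this links tree series
to `cutSeries`. -/
theorem conv_node (u : Character d N) (τ : DTree d → ℝ) (ν : Fin d) (g : Forest d) :
    conv u τ (DTree.node ν g) =
      u.val {DTree.node ν g} + linearExt (fun f => τ (DTree.node ν f)) (cut u g) := by
  have h : (evalAlg τ).toLinearMap ∘ₗ rootLin ν = linearExt (fun f => τ (DTree.node ν f)) :=
    forestAlg_hom_ext fun f => by
      rw [linearExt_basis, LinearMap.comp_apply, rootLin, linearExt_basis]
      change evalAlg τ _ = _
      rw [evalAlg_basis, Multiset.map_singleton, Multiset.prod_singleton]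
  rw [conv, cut_singleton_node, map_add, map_smul, map_one, smul_eq_mul, mul_one, ← h]
  rfl

end Algebra

/-! ### Forest combinatorics, symmetry factors, and the coefficients of coherent paths. -/

section Trees

variable {d : ℕ}

/-! ### Orderings of forests -/

/-- The forest of the entries of a tuple of trees. -/
def tupleForest {p : ℕ} (h : Fin p → DTree d) : Forest d := (List.ofFn h : List (DTree d))

theorem card_tupleForest {p : ℕ} (h : Fin p → DTree d) : Multiset.card (tupleForest h) = p := by
  simp [tupleForest]

theorem map_tupleForest {α : Type*} {p : ℕ} (h : Fin p → DTree d) (β : DTree d → α) :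
    (tupleForest h).map β = (List.ofFn (fun j => β (h j)) : List α) := by
  rw [tupleForest, Multiset.map_coe, List.map_ofFn]
  rfl

theorem prod_map_tupleForest {p : ℕ} (h : Fin p → DTree d) {M : Type*} [CommMonoid M]
    (β : DTree d → M) :
    ((tupleForest h).map β).prod = ∏ j, β (h j) := by
  rw [map_tupleForest, Multiset.prod_coe, List.prod_ofFn]

theorem prod_basis_tuple {p : ℕ} (h : Fin p → DTree d) :
    ∏ j, Forest.basis {h j} = Forest.basis (tupleForest h) := by
  have key : ∀ f : Forest d, (f.map fun t => Forest.basis {t}).prod = Forest.basis f := by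
    intro f
    induction f using Multiset.induction_on with
    | empty => simp [basis_zero]
    | cons t f ih =>
      rw [Multiset.map_cons, Multiset.prod_cons, ih, ← basis_add, Multiset.singleton_add]
  rw [← key, prod_map_tupleForest]

open Classical in
/-- The number of orderings of a forest. -/
def orderings (f : Forest d) : ℕ := f.toList.permutations.toFinset.card

theorem orderings_le (f : Forest d) : orderings f ≤ (Multiset.card f).factorial := by
  classical
  refine (List.toFinset_card_le _).trans ?_
  rw [List.length_permutations, Multiset.length_toList]

open Classical in
theorem card_tuples (f : Forest d) (n : ℕ) (hn : ∀ h ∈ f, h.order ≤ n) :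
    ((Fintype.piFinset (fun _ : Fin (Multiset.card f) => DTree.upTo d n)).filter
      (fun h => tupleForest h = f)).card = orderings f := by
  have hperm : ∀ l : List (DTree d), l ∈ f.toList.permutations.toFinset ↔ (l : Multiset _) = f := by
    intro l
    rw [List.mem_toFinset, List.mem_permutations, ← Multiset.coe_eq_coe, Multiset.coe_toList]
  refine Finset.card_bij (fun h _ => List.ofFn h) ?_ ?_ ?_
  · intro h hh
    exact (hperm _).2 (Finset.mem_filter.1 hh).2
  · intro h _ h' _ e
    exact List.ofFn_injective e
  · intro l hl
    have hl' := (hperm l).1 hl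
    have hlen : l.length = Multiset.card f := by rw [← hl', Multiset.coe_card]
    refine ⟨fun j => l.get (Fin.cast hlen.symm j), ?_, ?_⟩
    · have e : List.ofFn (fun j => l.get (Fin.cast hlen.symm j)) = l := by
        apply List.ext_get <;> simp [hlen]
      rw [Finset.mem_filter, Fintype.mem_piFinset]
      refine ⟨fun j => DTree.mem_upTo.2 (hn _ ?_), ?_⟩
      · have hmem : ∀ a ∈ l, a ∈ f := fun a ha => hl' ▸ Multiset.mem_coe.2 ha
        exact hmem _ (l.get_mem _)
      · rw [tupleForest, e, hl']
    · apply List.ext_get <;> simp [hlen]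

/-- The proportion of orderings of a forest among all permutations of its trees, the inverse of
`∏ mult!`. -/
def orderingRatio (f : Forest d) : ℝ := ((Multiset.card f).factorial : ℝ)⁻¹ * orderings f

theorem orderingRatio_nonneg (f : Forest d) : 0 ≤ orderingRatio f := by
  unfold orderingRatio; positivity

theorem orderingRatio_le_one (f : Forest d) : orderingRatio f ≤ 1 := by
  unfold orderingRatio
  rw [inv_mul_le_one₀ (by exact_mod_cast Nat.factorial_pos _)]
  exact_mod_cast orderings_le f

/-! ### Inverse symmetry factors -/

/-- The inverse symmetry factor of a tree. -/
def symInv : DTree d → ℝ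
  | h => orderingRatio h.children * (h.children.attach.map (fun t => symInv t.1)).prod
termination_by h => h.order
decreasing_by exact DTree.order_lt_of_mem_children t.2

theorem symInv_node (μ : Fin d) (f : Forest d) :
    symInv (DTree.node μ f) = orderingRatio f * (f.map symInv).prod := by
  rw [symInv, DTree.children_node]
  congr 2
  exact Multiset.attach_map_val' f symInv

theorem symInv_mem_Icc (h : DTree d) : symInv h ∈ Set.Icc (0 : ℝ) 1 := by
  induction h using DTree.induct with
  | step μ f ih =>
    rw [symInv_node]
    have : (f.map symInv).prod ∈ Set.Icc (0 : ℝ) 1 := by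
      induction f using Multiset.induction_on with
      | empty => simp
      | cons t f ihf =>
        rw [Multiset.map_cons, Multiset.prod_cons]
        have h1 := ih t (Multiset.mem_cons_self _ _)
        have h2 := ihf fun s hs => ih s (Multiset.mem_cons_of_mem hs)
        exact ⟨mul_nonneg h1.1 h2.1, mul_le_one₀ h1.2 h2.1 h2.2⟩
    exact ⟨mul_nonneg (orderingRatio_nonneg f) this.1,
      mul_le_one₀ (orderingRatio_le_one f) this.1 this.2⟩

/-! ### Finite sets of forests -/

theorem finite_forest_order_lt (d n : ℕ) : {f : Forest d | Forest.order f < n}.Finite := by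
  have : {f : Forest d | Forest.order f < n} ⊆
      ⋃ p : Fin n, (fun h : Fin p → DTree d => tupleForest h) ''
        (Fintype.piFinset (fun _ : Fin p => DTree.upTo d n) : Set (Fin p → DTree d)) := by
    intro f hf
    have hf' : Forest.order f < n := hf
    rw [Set.mem_iUnion]
    have hlen : f.toList.length = Multiset.card f := f.length_toList
    refine ⟨⟨f.toList.length, by
      rw [hlen]; exact (DTree.card_le_order f).trans_lt hf'⟩, f.toList.get, ?_, ?_⟩
    · rw [Finset.mem_coe, Fintype.mem_piFinset]
      intro j
      rw [DTree.mem_upTo]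
      exact (DTree.order_le_of_mem (Multiset.mem_toList.1 (f.toList.get_mem j))).trans hf'.le
    · change ((List.ofFn f.toList.get : List _) : Multiset _) = f
      rw [List.ofFn_get, Multiset.coe_toList]
  refine (Set.finite_iUnion fun p => ?_).subset this
  exact (Finset.finite_toSet _).image _

/-- The finite set of forests of order less than `n`. -/
def forestsLT (d n : ℕ) : Finset (Forest d) := (finite_forest_order_lt d n).toFinset

@[simp] theorem mem_forestsLT {n : ℕ} {f : Forest d} : f ∈ forestsLT d n ↔ Forest.order f < n := by
  simp [forestsLT]

theorem sum_upTo_eq {M : Type*} [AddCommMonoid M] (n : ℕ) (F : DTree d → M) :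
    ∑ h ∈ DTree.upTo d n, F h = ∑ μ : Fin d, ∑ f ∈ forestsLT d n, F (DTree.node μ f) := by
  rw [← Finset.sum_product' Finset.univ (forestsLT d n) fun μ f => F (DTree.node μ f)]
  refine Finset.sum_nbij' (fun h => (h.root, h.children)) (fun x => DTree.node x.1 x.2) ?_ ?_ ?_ ?_ ?_
  · intro h hh
    have := DTree.order_eq h
    simp only [DTree.mem_upTo] at hh
    simp only [Finset.mem_product, Finset.mem_univ, true_and, mem_forestsLT]
    omega
  · rintro ⟨μ, f⟩ hf
    simp only [Finset.mem_product, Finset.mem_univ, true_and, mem_forestsLT] at hf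
    rw [DTree.mem_upTo, DTree.order_node]
    exact hf
  · intro h _
    simp
  · rintro ⟨μ, f⟩ _
    simp
  · intro h _
    simp

/-! ### Composition with smooth functions -/

theorem coeff_truncate (n : ℕ) (a : ForestAlg d) (f : Forest d) :
    (truncate n a).coeff f = if Forest.order f ≤ n then a.coeff f else 0 := by
  classical
  have h : coeffLin f ∘ₗ truncate n = if Forest.order f ≤ n then coeffLin f else 0 := by
    refine forestAlg_hom_ext fun g => ?_
    rw [LinearMap.comp_apply, truncate, linearExt_basis]
    have e : ∀ g : Forest d, coeffLin f (Forest.basis g) = if g = f then 1 else 0 :=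
      fun g => coeffLin_basis f g
    by_cases hg : g = f
    · subst hg
      split_ifs <;> simp
    · split_ifs <;> simp [e, hg]
  have h' := LinearMap.congr_fun h a
  change coeffLin f (truncate n a) = _
  rw [LinearMap.comp_apply] at h'
  rw [h']
  split_ifs <;> rfl

variable {k : ℕ}

local notation "𝔼" => EuclideanSpace ℝ (Fin k)

-- Only tuples of length #f can enumerate `f`. By symmetry of the derivative each distinct ordering
-- contributes the same vector, and the weight 1/p! turns their number into `orderingRatio`.
open Classical in
theorem sum_tuples_eq {N : ℕ} {G : 𝔼 → 𝔼} (hG : ContDiff ℝ N G) (x : 𝔼) (β : DTree d → 𝔼) (n : ℕ)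
    (f : Forest d) (hf : Forest.order f ≤ n) (hfN : Multiset.card f < N) :
    ∑ p ∈ Finset.range N, ((p.factorial : ℝ)⁻¹) •
      ∑ h ∈ (Fintype.piFinset (fun _ : Fin p => DTree.upTo d n)).filter
        (fun h => tupleForest h = f),
        iteratedFDeriv ℝ p G x (fun j => β (h j)) =
    orderingRatio f • multiDeriv G x (f.map β) := by
  rw [Finset.sum_eq_single (Multiset.card f)]
  · have h1 : ∀ h ∈ (Fintype.piFinset (fun _ : Fin (Multiset.card f) => DTree.upTo d n)).filter
        (fun h => tupleForest h = f),
        iteratedFDeriv ℝ (Multiset.card f) G x (fun j => β (h j)) = multiDeriv G x (f.map β) := by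
      intro h hh
      rw [iteratedFDeriv_eq_multiDeriv (hG.of_le (by exact_mod_cast hfN.le)), ← map_tupleForest,
        (Finset.mem_filter.1 hh).2]
    rw [Finset.sum_congr rfl h1, Finset.sum_const,
      card_tuples f n fun h hh => (DTree.order_le_of_mem hh).trans hf, orderingRatio, mul_smul,
      Nat.cast_smul_eq_nsmul]
  · intro p _ hp
    rw [Finset.filter_false_of_mem, Finset.sum_empty, smul_zero]
    intro h _ e
    exact hp (by rw [← e, card_tupleForest])
  · intro h
    exact absurd (Finset.mem_range.2 hfN) h

theorem coeffVec_compose {N : ℕ} (hN : 1 ≤ N) {G : 𝔼 → 𝔼} (hG : ContDiff ℝ N G)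
    (y : Fin k → ForestAlg d) (f : Forest d) :
    coeffVec (compose N G y) f = if Forest.order f ≤ N - 1 then
      orderingRatio f • multiDeriv G (coeffVec y 0) (f.map fun h => coeffVec y {h}) else 0 := by
  classical
  split_ifs with hf
  · have hc := DTree.card_le_order f
    rw [← sum_tuples_eq hG (coeffVec y 0) (fun h => coeffVec y {h}) (N - 1) f hf (by omega)]
    ext i
    change (compose N G y i).coeff f = _
    rw [compose, coeff_truncate, if_pos hf]
    change coeffLin f _ = _
    rw [map_sum]
    simp only [map_smul, map_sum, prod_basis_tuple]
    have e : ∀ g : Forest d, coeffLin f (Forest.basis g) = if g = f then 1 else 0 :=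
      fun g => coeffLin_basis f g
    simp only [e, smul_eq_mul, mul_ite, mul_one, mul_zero, Finset.sum_filter]
    simp only [WithLp.ofLp_sum, WithLp.ofLp_smul, Finset.sum_apply, Pi.smul_apply, smul_eq_mul]
    refine Finset.sum_congr rfl fun p _ => ?_
    congr 1
    refine Finset.sum_congr rfl fun h _ => ?_
    split_ifs <;> rfl
  · ext i
    change (compose N G y i).coeff f = 0
    rw [compose, coeff_truncate, if_neg hf]

/-! ### Normalized elementary differentials -/

/-- The elementary differential of a tree divided by its symmetry factor. -/
def normDiff (σ : Fin d → 𝔼 → 𝔼) (h : DTree d) (x : 𝔼) : 𝔼 := symInv h • upsilonTree σ h x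

/-- By multilinearity, dividing by symmetry factors yields the very recursion met by the
coefficients of a composition in `coeffVec_compose`. -/
theorem normDiff_node {N : ℕ} {σ : Fin d → 𝔼 → 𝔼} (hσ : ∀ μ, ContDiff ℝ N (σ μ)) (μ : Fin d)
    (f : Forest d) (hf : Multiset.card f ≤ N) (x : 𝔼) :
    normDiff σ (DTree.node μ f) x =
      orderingRatio f • multiDeriv (σ μ) x (f.map fun h => normDiff σ h x) := by
  unfold normDiff
  rw [multiDeriv_map_smul f symInv _ ((hσ μ).of_le (by exact_mod_cast hf)), symInv_node, mul_smul,
    ← upsilon_eq]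
  rfl

/-- Below the root lie |f| nodes: the derivative of order #f ≤ |f| costs at most that many orders of
smoothness, and so does each child, being of order at most |f|. -/
theorem contDiff_upsilonTree {N : ℕ} {σ : Fin d → 𝔼 → 𝔼} (hσ : ∀ μ, ContDiff ℝ N (σ μ))
    (h : DTree d) (hh : h.order ≤ N + 1) :
    ContDiff ℝ (N + 1 - h.order : ℕ) (upsilonTree σ h) := by
  induction h using DTree.induct with
  | step μ f ih =>
    rw [DTree.order_node] at hh ⊢
    have e : upsilonTree σ (DTree.node μ f) =
        fun x => multiDeriv (σ μ) x (f.map fun t => upsilonTree σ t x) :=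
      funext fun x => upsilon_eq σ μ f x
    rw [e]
    have hc := DTree.card_le_order f
    refine contDiff_multiDeriv (hσ μ) f (upsilonTree σ) (by norm_cast; omega) fun t ht => ?_
    have := DTree.order_le_of_mem ht
    exact (ih t ht (by omega)).of_le (by norm_cast; omega)

theorem contDiff_normDiff {N : ℕ} {σ : Fin d → 𝔼 → 𝔼} (hσ : ∀ μ, ContDiff ℝ N (σ μ))
    (h : DTree d) (hh : h.order ≤ N + 1) :
    ContDiff ℝ (N + 1 - h.order : ℕ) (normDiff σ h) := by
  exact (contDiff_const (c := symInv h)).smul (contDiff_upsilonTree hσ h hh)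

/-! ### Coherent tree paths -/

section CoherentPaths

variable {N : ℕ} {T : ℝ}

/-- Coherence expresses the coefficient of [f]_μ through the base point and the coefficients of the
smaller trees in f, by the recursion of `normDiff_node`. -/
theorem coeffVec_singleton_of_coherent {σ : Fin d → 𝔼 → 𝔼}
    {Y : TreePath d k N T} (hN : 1 ≤ N) (hσ : ∀ μ, ContDiff ℝ N (σ μ))
    (hY : Coherent σ Y) {s : Set.Icc (0 : ℝ) T} (hs : 0 < (s : ℝ)) (h : DTree d)
    (hh : h.order ≤ N - 1) : coeffVec (Y.toAlg s) {h} = normDiff σ h (Y.base s) := by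
  induction h using DTree.induct with
  | step μ f ih =>
    rw [← hY μ f hh s hs]
    rw [DTree.order_node] at hh
    have hc := DTree.card_le_order f
    rw [TreePath.comp, coeffVec_compose hN (hσ μ), if_pos (by omega),
      normDiff_node hσ μ f (by omega)]
    congr 2
    refine Multiset.map_congr rfl fun t ht => ?_
    have := DTree.order_le_of_mem ht
    exact ih t ht (by omega)

theorem coeffVec_comp_of_coherent {σ : Fin d → 𝔼 → 𝔼}
    {Y : TreePath d k N T} (hN : 1 ≤ N) (hσ : ∀ μ, ContDiff ℝ N (σ μ))
    (hY : Coherent σ Y) {s : Set.Icc (0 : ℝ) T} (hs : 0 < (s : ℝ)) (μ : Fin d) (f : Forest d) :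
    coeffVec (Y.comp (σ μ) s) f =
      if Forest.order f < N then normDiff σ (DTree.node μ f) (Y.base s) else 0 := by
  rw [TreePath.comp, coeffVec_compose hN (hσ μ)]
  have hiff : Forest.order f ≤ N - 1 ↔ Forest.order f < N := by omega
  simp only [hiff]
  split_ifs with hf
  · have hc := DTree.card_le_order f
    rw [normDiff_node hσ μ f (by omega)]
    congr 2
    refine Multiset.map_congr rfl fun t ht => ?_
    have := DTree.order_le_of_mem ht
    exact coeffVec_singleton_of_coherent hN hσ hY hs t (by omega)
  · rfl

theorem TreePath.coeffVec_toAlg_eq_zero (Y : TreePath d k N T) (s : Set.Icc (0 : ℝ) T)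
    (f : Forest d) (hf : f ∉ treesLE d (N - 1)) : coeffVec (Y.toAlg s) f = 0 := by
  ext i
  change (Y s i : ForestAlg d).coeff f = 0
  have h := AddMonoidAlgebra.mem_supported.1 (Y s i).2
  by_contra h0
  exact hf (h (Finset.mem_coe.2 (Finsupp.mem_support_iff.2 h0)))

end CoherentPaths

end Trees

open Filter Topology Asymptotics

/-! ### Extraction of polynomial coefficients modulo a subspace. -/

section Extraction

/-- The subspace of functions that are `O(g)` along `l`. -/
def bigOSubmodule {ι : Type*} (E : Type*) [NormedAddCommGroup E] [NormedSpace ℝ E] (l : Filter ι)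
    (g : ι → ℝ) : Submodule ℝ (ι → E) where
  carrier := {q | q =O[l] g}
  zero_mem' := isBigO_zero _ _
  add_mem' := fun h h' => h.add h'
  smul_mem' := fun c _ h => h.const_smul_left c

/-- If a finite sum of monomials with coefficients in a vector space takes values in a subspace,
then so do its coefficients. -/
theorem coeff_mem_of_forall_sum_mem {α V : Type*} [AddCommGroup V] [Module ℝ V]
    (W : Submodule ℝ V) (P : α → Prop) (F : Finset (Multiset α)) (a : Multiset α → V)
    (h : ∀ τ : α → ℝ, (∀ t, ¬ P t → τ t = 0) → ∑ f ∈ F, (f.map τ).prod • a f ∈ W)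
    (f : Multiset α) (hfF : f ∈ F) (hf : ∀ t ∈ f, P t) : a f ∈ W := by
  classical
  by_contra hW
  -- A linear form that vanishes on `W` but not on `a f` reduces the claim to real polynomials.
  obtain ⟨ℓ, hℓ, hker⟩ := Submodule.exists_le_ker_of_notMem hW
  let p : MvPolynomial α ℝ := ∑ g ∈ F.filter (fun g => ∀ t ∈ g, P t),
    MvPolynomial.monomial (Multiset.toFinsupp g) (ℓ (a g))
  have hmon : ∀ (τ : α → ℝ) (g : Multiset α),
      ((Multiset.toFinsupp g).prod fun n e => τ n ^ e) = (g.map τ).prod := by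
    intro τ g
    rw [Finset.prod_multiset_map_count, Finsupp.prod, Multiset.toFinsupp_support]
    simp only [Multiset.toFinsupp_apply]
  -- A real polynomial vanishing at every point is zero. Setting τ to 0 off `P` kills exactly the
  -- monomials left out of `p`.
  have hp : p = 0 := by
    refine MvPolynomial.funext fun τ => ?_
    let τ' : α → ℝ := fun t => if P t then τ t else 0
    have h1 := hker (h τ' fun t ht => if_neg ht)
    rw [LinearMap.mem_ker, map_sum] at h1
    rw [map_zero, ← h1, map_sum, Finset.sum_filter]
    refine Finset.sum_congr rfl fun g _ => ?_
    rw [map_smul, smul_eq_mul]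
    split_ifs with hg
    · rw [MvPolynomial.eval_monomial, hmon, mul_comm]
      congr 2
      exact Multiset.map_congr rfl fun t ht => (if_pos (hg t ht)).symm
    · push Not at hg
      obtain ⟨t, ht, hPt⟩ := hg
      have : (g.map τ').prod = 0 :=
        Multiset.prod_eq_zero (Multiset.mem_map.2 ⟨t, ht, if_neg hPt⟩)
      rw [this, zero_mul]
  apply hℓ
  have hc : MvPolynomial.coeff (Multiset.toFinsupp f) p = ℓ (a f) := by
    rw [MvPolynomial.coeff_sum, Finset.sum_eq_single f]
    · rw [MvPolynomial.coeff_monomial, if_pos rfl]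
    · intro g _ hg
      rw [MvPolynomial.coeff_monomial, if_neg fun e => hg (Multiset.toFinsupp.injective e)]
    · intro h0
      exact absurd (Finset.mem_filter.2 ⟨hfF, hf⟩) h0
  rw [← hc, hp, MvPolynomial.coeff_zero]

end Extraction

/-! ### Asymptotic bounds along bounded families of points. -/

section Asymptotics

theorem isBigO_one_comp_of_bounded {ι E V : Type*} [NormedAddCommGroup E] [ProperSpace E]
    [NormedAddCommGroup V] {F : E → V} (hF : Continuous F) {l : Filter ι} {x : ι → E}
    (hx : x =O[l] fun _ => (1 : ℝ)) : (fun i => F (x i)) =O[l] fun _ => (1 : ℝ) := by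
  obtain ⟨R, hR⟩ := hx.bound
  obtain ⟨C, hC⟩ := (isCompact_closedBall (0 : E) R).exists_bound_of_continuousOn hF.continuousOn
  refine IsBigO.of_bound C ?_
  filter_upwards [hR] with i hi
  simpa using hC (x i) (by simpa using hi)

theorem isBigO_sub_comp_of_bounded {ι E V : Type*} [NormedAddCommGroup E] [NormedSpace ℝ E]
    [ProperSpace E] [NormedAddCommGroup V] [NormedSpace ℝ V] {F : E → V} (hF : ContDiff ℝ 1 F)
    {l : Filter ι} {x y : ι → E} (hx : x =O[l] fun _ => (1 : ℝ)) (hy : y =O[l] fun _ => (1 : ℝ)) :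
    (fun i => F (x i) - F (y i)) =O[l] fun i => x i - y i := by
  obtain ⟨R, hR⟩ := hx.bound
  obtain ⟨R', hR'⟩ := hy.bound
  obtain ⟨C, hC⟩ := (isCompact_closedBall (0 : E) (max R R')).exists_bound_of_continuousOn
    (hF.continuous_fderiv one_ne_zero).continuousOn
  refine IsBigO.of_bound C ?_
  filter_upwards [hR, hR'] with i hi hi'
  refine (convex_closedBall (0 : E) (max R R')).norm_image_sub_le_of_norm_fderiv_le
    (fun z _ => hF.differentiable one_ne_zero z) hC ?_ ?_
  · simpa using Or.inr hi'
  · simpa using Or.inl hi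

theorem isBigO_pow_of_le {n m : ℕ} (h : n ≤ m) :
    (fun ε : ℝ => ε ^ m) =O[𝓝[>] 0] fun ε => ε ^ n := by
  refine IsBigO.of_bound 1 ?_
  filter_upwards [Ioo_mem_nhdsGT (zero_lt_one' ℝ)] with ε hε
  rw [one_mul, norm_pow, norm_pow, Real.norm_of_nonneg hε.1.le]
  exact pow_le_pow_of_le_one hε.1.le hε.2.le h

end Asymptotics

/-! ### Tree series and their composition with the vector fields. -/

section BSeries

variable {d k : ℕ}

local notation "𝔼" => EuclideanSpace ℝ (Fin k)

theorem Forest.order_cons (h : DTree d) (f : Forest d) :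
    Forest.order (h ::ₘ f) = h.order + Forest.order f := by
  simp [Forest.order]

theorem prod_map_pow_order (ε : ℝ) (ψ : DTree d → ℝ) (f : Forest d) :
    (f.map fun h => ε ^ h.order * ψ h).prod = ε ^ Forest.order f * (f.map ψ).prod := by
  induction f using Multiset.induction_on with
  | empty => simp [Forest.order]
  | cons h f ih =>
    rw [Multiset.map_cons, Multiset.prod_cons, ih, Forest.order_cons, Multiset.map_cons,
      Multiset.prod_cons, pow_add]
    ring

theorem one_le_order (h : DTree d) : 1 ≤ h.order := by
  rw [DTree.order_eq]; omega

theorem continuous_normDiff {N : ℕ} {σ : Fin d → 𝔼 → 𝔼} (hσ : ∀ μ, ContDiff ℝ N (σ μ))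
    (h : DTree d) (hh : h.order ≤ N + 1) : Continuous (normDiff σ h) :=
  (contDiff_normDiff hσ h hh).continuous

/-- The truncated series `∑ ε^|h| ψ(h) B_h(x)` over trees. -/
def treeSeries (N : ℕ) (σ : Fin d → 𝔼 → 𝔼) (ψ : DTree d → ℝ) (x : 𝔼) (ε : ℝ) : 𝔼 :=
  ∑ h ∈ DTree.upTo d (N - 1), (ε ^ h.order * ψ h) • normDiff σ h x

theorem isBigO_treeSeries {N : ℕ} {σ : Fin d → 𝔼 → 𝔼} (hσ : ∀ μ, ContDiff ℝ N (σ μ))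
    (ψ : DTree d → ℝ) {x : ℝ → 𝔼} (hx : x =O[𝓝[>] 0] fun _ => (1 : ℝ)) :
    (fun ε => treeSeries N σ ψ (x ε) ε) =O[𝓝[>] 0] fun ε => ε := by
  refine IsBigO.fun_sum fun h hh => ?_
  rw [DTree.mem_upTo] at hh
  have h1 := isBigO_one_comp_of_bounded (continuous_normDiff hσ h (by omega)) hx
  have h2 : (fun ε : ℝ => ε ^ h.order * ψ h) =O[𝓝[>] 0] fun ε => ε := by
    have := isBigO_pow_of_le (one_le_order h)
    simp only [pow_one] at this
    simpa only [mul_comm] using this.const_mul_left (ψ h)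
  simpa using h2.smul h1

theorem isBigO_taylor {N : ℕ} (hN : 1 ≤ N) {G : 𝔼 → 𝔼} (hG : ContDiff ℝ N G) {x y : ℝ → 𝔼}
    (hx : x =O[𝓝[>] 0] fun _ => (1 : ℝ)) (hy : y =O[𝓝[>] 0] fun ε => ε) :
    (fun ε => G (x ε + y ε) - ∑ p ∈ Finset.range N,
      (p.factorial : ℝ)⁻¹ • iteratedFDeriv ℝ p G (x ε) fun _ => y ε) =O[𝓝[>] 0]
      fun ε => ε ^ N := by
  obtain ⟨R, hR⟩ := hx.bound
  obtain ⟨R', hR'⟩ := hy.bound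
  obtain ⟨C, hC⟩ := (isCompact_closedBall (0 : 𝔼) (R + |R'|)).exists_bound_of_continuousOn
    (hG.continuous_iteratedFDeriv (m := N) le_rfl).continuousOn
  refine IsBigO.trans ?_ (hy.norm_left.pow N)
  refine IsBigO.of_bound C ?_
  filter_upwards [hR, hR', Ioo_mem_nhdsGT (zero_lt_one' ℝ)] with ε h1 h2 hε
  have hy1 : ‖y ε‖ ≤ |R'| := by
    refine h2.trans ?_
    rw [Real.norm_of_nonneg hε.1.le]
    calc R' * ε ≤ |R'| * ε := mul_le_mul_of_nonneg_right (le_abs_self _) hε.1.le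
      _ ≤ |R'| := mul_le_of_le_one_right (abs_nonneg _) hε.2.le
  have hx1 : ‖x ε‖ ≤ R := by simpa using h1
  have := norm_sub_taylor_le N hN hG (x ε) (y ε) (K := C * ‖y ε‖ ^ N) (t := 1) zero_le_one (by
    intro τ hτ
    rw [multiDeriv_replicate N hG]
    refine (ContinuousMultilinearMap.le_opNorm _ _).trans ?_
    rw [Finset.prod_const, Finset.card_univ, Fintype.card_fin]
    refine mul_le_mul_of_nonneg_right (hC _ ?_) (by positivity)
    rw [mem_closedBall_zero_iff]
    refine (norm_add_le _ _).trans (add_le_add hx1 ?_)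
    rw [norm_smul, Real.norm_of_nonneg hτ.1]
    exact (mul_le_of_le_one_left (norm_nonneg _) hτ.2).trans hy1)
  simp only [one_smul, one_pow, mul_one] at this
  rw [norm_pow, norm_norm]
  convert this using 3
  refine Finset.sum_congr rfl fun p hp => ?_
  rw [multiDeriv_replicate p (hG.of_le (by exact_mod_cast (Finset.mem_range.1 hp).le))]

/-- The composition of a smooth function with a truncated tree series is a truncated series over
forests. -/
theorem isBigO_forestSeries {N : ℕ} (hN : 1 ≤ N) {σ : Fin d → 𝔼 → 𝔼}
    (hσ : ∀ μ, ContDiff ℝ N (σ μ)) (μ : Fin d) (ψ : DTree d → ℝ) {x : ℝ → 𝔼}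
    (hx : x =O[𝓝[>] 0] fun _ => (1 : ℝ)) :
    (fun ε => σ μ (x ε + treeSeries N σ ψ (x ε) ε) -
      ∑ f ∈ forestsLT d N, (ε ^ Forest.order f * (f.map ψ).prod) •
        normDiff σ (DTree.node μ f) (x ε)) =O[𝓝[>] 0] fun ε => ε ^ N := by
  classical
  let J : (p : ℕ) → Finset (Fin p → DTree d) := fun p =>
    Fintype.piFinset fun _ : Fin p => DTree.upTo d (N - 1)
  let c : ℝ → Forest d → ℝ := fun ε f => ε ^ Forest.order f * (f.map ψ).prod
  let D : (p : ℕ) → (Fin p → DTree d) → 𝔼 → 𝔼 := fun p h z =>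
    iteratedFDeriv ℝ p (σ μ) z fun j => normDiff σ (h j) z
  have hS : ∀ ε, ∑ p ∈ Finset.range N, (p.factorial : ℝ)⁻¹ •
      (iteratedFDeriv ℝ p (σ μ) (x ε) fun _ => treeSeries N σ ψ (x ε) ε) =
      ∑ p ∈ Finset.range N, (p.factorial : ℝ)⁻¹ •
        ∑ h ∈ J p, c ε (tupleForest h) • D p h (x ε) := by
    intro ε
    refine Finset.sum_congr rfl fun p _ => ?_
    congr 1
    unfold treeSeries
    rw [ContinuousMultilinearMap.map_sum_finset]
    refine Finset.sum_congr rfl fun h _ => ?_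
    rw [ContinuousMultilinearMap.map_smul_univ]
    congr 1
    rw [← prod_map_tupleForest h fun h => ε ^ h.order * ψ h, prod_map_pow_order]
  -- The forest series regroups, by underlying forest, the multilinear Taylor terms of total order
  -- below N.
  have hT : ∀ ε, ∑ f ∈ forestsLT d N, c ε f • normDiff σ (DTree.node μ f) (x ε) =
      ∑ p ∈ Finset.range N, (p.factorial : ℝ)⁻¹ •
        ∑ h ∈ (J p).filter (fun h => Forest.order (tupleForest h) < N),
          c ε (tupleForest h) • D p h (x ε) := by
    intro ε
    have h1 : ∀ f ∈ forestsLT d N, c ε f • normDiff σ (DTree.node μ f) (x ε) =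
        ∑ p ∈ Finset.range N, (p.factorial : ℝ)⁻¹ •
          ∑ h ∈ (J p).filter (fun h => tupleForest h = f), c ε (tupleForest h) • D p h (x ε) := by
      intro f hf
      rw [mem_forestsLT] at hf
      have hc := DTree.card_le_order f
      rw [normDiff_node hσ μ f (by omega),
        ← sum_tuples_eq (hσ μ) (x ε) (fun h => normDiff σ h (x ε)) (N - 1) f (by omega) (by omega),
        Finset.smul_sum]
      refine Finset.sum_congr rfl fun p _ => ?_
      rw [smul_comm, Finset.smul_sum]
      congr 1
      refine Finset.sum_congr rfl fun h hh => ?_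
      rw [(Finset.mem_filter.1 hh).2]
    rw [Finset.sum_congr rfl h1, Finset.sum_comm]
    refine Finset.sum_congr rfl fun p _ => ?_
    rw [← Finset.smul_sum]
    congr 1
    rw [← Finset.sum_fiberwise_of_maps_to (s := (J p).filter _) (t := forestsLT d N)
      (g := tupleForest) fun h hh => mem_forestsLT.2 (Finset.mem_filter.1 hh).2]
    refine Finset.sum_congr rfl fun f hf => Finset.sum_congr ?_ fun _ _ => rfl
    ext h
    simp only [Finset.mem_filter, and_assoc]
    refine and_congr_right fun _ => ⟨fun e => ⟨by rw [e]; exact mem_forestsLT.1 hf, e⟩, fun e => e.2⟩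
  have hA := isBigO_taylor hN (hσ μ) hx (isBigO_treeSeries hσ ψ hx)
  -- Tuples of trees of order at most N - 1 may have total order N or more; these surplus terms
  -- carry at least ε^N.
  have hB : (fun ε => ∑ p ∈ Finset.range N, (p.factorial : ℝ)⁻¹ •
      ∑ h ∈ (J p).filter (fun h => ¬ Forest.order (tupleForest h) < N),
        c ε (tupleForest h) • D p h (x ε)) =O[𝓝[>] 0] fun ε => ε ^ N := by
    refine IsBigO.fun_sum fun p hp => ?_
    suffices hsum : (fun ε => ∑ h ∈ (J p).filter (fun h => ¬ Forest.order (tupleForest h) < N),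
        c ε (tupleForest h) • D p h (x ε)) =O[𝓝[>] 0] fun ε => ε ^ N from
      hsum.const_smul_left (p.factorial : ℝ)⁻¹
    refine IsBigO.fun_sum fun h hh => ?_
    rw [Finset.mem_range] at hp
    rw [Finset.mem_filter, Fintype.mem_piFinset] at hh
    have hD : Continuous (D p h) := by
      refine (contDiff_multilinear_apply (n := 0) ((hσ μ).iteratedFDeriv_right (i := p) ?_)
        fun j => ?_).continuous
      · rw [zero_add]; exact_mod_cast hp.le
      · have := DTree.mem_upTo.1 (hh.1 j)
        exact (contDiff_normDiff hσ (h j) (by omega)).of_le zero_le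
    have h1 := isBigO_one_comp_of_bounded hD hx
    have h2 : (fun ε => c ε (tupleForest h)) =O[𝓝[>] 0] fun ε => ε ^ N := by
      have := isBigO_pow_of_le (not_lt.1 hh.2)
      simpa only [c, mul_comm] using this.const_mul_left ((tupleForest h).map ψ).prod
    simpa using h2.smul h1
  refine (hA.add hB).congr_left fun ε => ?_
  rw [hS, hT, sub_add, ← Finset.sum_sub_distrib]
  congr 1
  refine Finset.sum_congr rfl fun p _ => ?_
  rw [← smul_sub, ← Finset.sum_filter_add_sum_filter_not (J p)
    (fun h => Forest.order (tupleForest h) < N), add_sub_cancel_right]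

end BSeries

/-! ### Contraction with a character as a shift of the base point. -/

section CutSeries

variable {d k : ℕ}

local notation "𝔼" => EuclideanSpace ℝ (Fin k)

/-- The `f`-coefficient of `(u ⊗ id) Δ` applied to the truncated forest series
`∑ ε^|g| B_{[g]_μ}(x) g`. -/
def cutSeries {N : ℕ} (u : Character d N) (σ : Fin d → 𝔼 → 𝔼) (x : 𝔼) (μ : Fin d) (f : Forest d)
    (ε : ℝ) : 𝔼 :=
  ∑ g ∈ forestsLT d N, (ε ^ Forest.order g * (cut u g).coeff f) • normDiff σ (DTree.node μ g) x

theorem evalAlg_eq_sum (τ : DTree d → ℝ) (a : ForestAlg d) {F : Finset (Forest d)}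
    (h : ∀ f, a.coeff f ≠ 0 → f ∈ F) :
    evalAlg τ a = ∑ f ∈ F, a.coeff f * (f.map τ).prod := by
  change (evalAlg τ).toLinearMap a = _
  rw [evalAlg_eq_linearExt, linearExt_eq_sum _ _ fun f hf _ => h f hf]
  rfl

theorem treeSeries_eq_sum_node {N : ℕ} (σ : Fin d → 𝔼 → 𝔼) (ψ : DTree d → ℝ) (x : 𝔼) (ε : ℝ) :
    treeSeries N σ ψ x ε = ∑ ν : Fin d, ∑ g ∈ forestsLT d (N - 1),
      (ε ^ (Forest.order g + 1) * ψ (DTree.node ν g)) • normDiff σ (DTree.node ν g) x := by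
  rw [treeSeries, sum_upTo_eq]
  simp only [DTree.order_node]

theorem treeSeries_eq_of_support {N j : ℕ} (hj : j ≤ N - 1) (σ : Fin d → 𝔼 → 𝔼)
    {τ : DTree d → ℝ} (hτ : ∀ h, ¬ h.order ≤ j → τ h = 0) (x : 𝔼) (ε : ℝ) :
    treeSeries N σ τ x ε = ∑ ν : Fin d, ∑ f ∈ forestsLT d j,
      (ε * τ (DTree.node ν f)) • ε ^ Forest.order f • normDiff σ (DTree.node ν f) x := by
  have h1 : treeSeries N σ τ x ε =
      ∑ h ∈ DTree.upTo d j, (ε ^ h.order * τ h) • normDiff σ h x := by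
    refine (Finset.sum_subset ?_ ?_).symm
    · intro h hh
      rw [DTree.mem_upTo] at hh ⊢
      exact hh.trans hj
    · intro h _ hh
      rw [DTree.mem_upTo] at hh
      rw [hτ h hh, mul_zero, zero_smul]
  rw [h1, sum_upTo_eq]
  refine Finset.sum_congr rfl fun ν _ => Finset.sum_congr rfl fun f _ => ?_
  rw [DTree.order_node, smul_smul]
  congr 1
  ring

theorem treeSeries_conv_sub {N j : ℕ} (u : Character d N) (σ : Fin d → 𝔼 → 𝔼)
    {τ : DTree d → ℝ} (hτ : ∀ h, ¬ h.order ≤ j → τ h = 0) (x : 𝔼) (ε : ℝ) :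
    treeSeries N σ (conv u τ) x ε - treeSeries N σ (fun h => u.val {h}) x ε =
      ∑ ν : Fin d, ∑ f ∈ forestsLT d j, (ε * τ (DTree.node ν f)) •
        ∑ g ∈ forestsLT d (N - 1),
          (ε ^ Forest.order g * (cut u g).coeff f) • normDiff σ (DTree.node ν g) x := by
  rw [treeSeries_eq_sum_node, treeSeries_eq_sum_node, ← Finset.sum_sub_distrib]
  refine Finset.sum_congr rfl fun ν _ => ?_
  simp only [Finset.smul_sum]
  rw [← Finset.sum_sub_distrib, Finset.sum_comm]
  refine Finset.sum_congr rfl fun g _ => ?_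
  rw [← sub_smul, conv_node, linearExt_eq_sum (F := forestsLT d j)]
  · simp only [smul_smul]
    rw [← Finset.sum_smul]
    congr 1
    rw [mul_add, add_sub_cancel_left, Finset.mul_sum]
    refine Finset.sum_congr rfl fun f _ => ?_
    rw [smul_eq_mul]
    ring
  · intro f _ hf
    rw [mem_forestsLT]
    by_contra h
    exact hf (hτ _ (by rw [DTree.order_node]; omega))

theorem isBigO_const_order_smul {n m : ℕ} (h : n ≤ m) (c : ℝ) (v : 𝔼) :
    (fun ε : ℝ => (ε ^ m * c) • v) =O[𝓝[>] 0] fun ε => ε ^ n := by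
  have h1 : (fun ε : ℝ => ε ^ m * c) =O[𝓝[>] 0] fun ε => ε ^ n := by
    simpa only [mul_comm] using (isBigO_pow_of_le h).const_mul_left c
  simpa using h1.smul (isBigO_const_const v (one_ne_zero' ℝ) (𝓝[>] (0 : ℝ)))

/-- Contracting the forest series at `x` with a character gives the forest series at the point
shifted by the tree series. -/
theorem isBigO_cutSeries_sub {N : ℕ} (hN : 1 ≤ N) {σ : Fin d → 𝔼 → 𝔼}
    (hσ : ∀ μ, ContDiff ℝ N (σ μ)) (u : Character d N) (x : 𝔼) (μ : Fin d) (f : Forest d)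
    (hf : Forest.order f < N) :
    (fun ε => cutSeries u σ x μ f ε - ε ^ Forest.order f •
      normDiff σ (DTree.node μ f) (x + treeSeries N σ (fun h => u.val {h}) x ε))
      =O[𝓝[>] 0] fun ε => ε ^ N := by
  classical
  induction hj : Forest.order f using Nat.strong_induction_on generalizing μ f with
  | _ j ih =>
  subst hj
  set z : ℝ → 𝔼 := treeSeries N σ (fun h => u.val {h}) x with hz
  have hx1 : (fun _ : ℝ => x) =O[𝓝[>] 0] fun _ => (1 : ℝ) :=
    isBigO_const_const x one_ne_zero _
  have hid : (fun ε : ℝ => ε) =O[𝓝[>] 0] fun _ => (1 : ℝ) := by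
    simpa using isBigO_pow_of_le (Nat.zero_le 1)
  have hxz1 : (fun ε => x + z ε) =O[𝓝[>] 0] fun _ => (1 : ℝ) :=
    hx1.add ((isBigO_treeSeries hσ (fun h => u.val {h}) hx1).trans hid)
  -- As τ lives on trees of order at most |f|, the difference only involves, with factors ε
  -- τ([g]_ν), the claim for forests g with |g| < |f|, where the strong induction applies.
  have hshift : ∀ τ : DTree d → ℝ, (∀ h, ¬ h.order ≤ Forest.order f → τ h = 0) →
      (fun ε => (x + treeSeries N σ (conv u τ) x ε) -
        ((x + z ε) + treeSeries N σ τ (x + z ε) ε)) =O[𝓝[>] 0] fun ε => ε ^ N := by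
    intro τ hτ
    have e : ∀ ε, (x + treeSeries N σ (conv u τ) x ε) -
        ((x + z ε) + treeSeries N σ τ (x + z ε) ε) =
        ∑ ν : Fin d, ∑ g ∈ forestsLT d (Forest.order f), (ε * τ (DTree.node ν g)) •
          (∑ g' ∈ forestsLT d (N - 1),
            (ε ^ Forest.order g' * (cut u g').coeff g) • normDiff σ (DTree.node ν g') x -
            ε ^ Forest.order g • normDiff σ (DTree.node ν g) (x + z ε)) := by
      intro ε
      simp only [smul_sub, Finset.sum_sub_distrib]
      rw [← treeSeries_conv_sub u σ hτ, ← treeSeries_eq_of_support (N := N) (by omega) σ hτ, hz]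
      abel
    simp only [e]
    refine IsBigO.fun_sum fun ν _ => IsBigO.fun_sum fun g hg => ?_
    rw [mem_forestsLT] at hg
    have h1 : (fun ε : ℝ => ε * τ (DTree.node ν g)) =O[𝓝[>] 0] fun ε => ε := by
      simpa only [mul_comm] using (isBigO_refl (fun ε : ℝ => ε) _).const_mul_left (τ (DTree.node ν g))
    have h2 : (fun ε => ∑ g' ∈ forestsLT d (N - 1),
            (ε ^ Forest.order g' * (cut u g').coeff g) • normDiff σ (DTree.node ν g') x -
            ε ^ Forest.order g • normDiff σ (DTree.node ν g) (x + z ε)) =O[𝓝[>] 0]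
          fun ε => ε ^ (N - 1) := by
      have h3 := (ih (Forest.order g) hg ν g (hg.trans hf) rfl).trans
        (isBigO_pow_of_le (Nat.sub_le N 1))
      -- Tree series stop at trees of order N - 1, so the forests under a root stop one order
      -- earlier than in `cutSeries`. The missing terms are O(ε^(N-1)), and the factor ε contributed
      -- by the root restores the power N.
      have h4 : (fun ε => ∑ g' ∈ (forestsLT d N).filter (fun g' => ¬ Forest.order g' < N - 1),
            (ε ^ Forest.order g' * (cut u g').coeff g) • normDiff σ (DTree.node ν g') x)
          =O[𝓝[>] 0] fun ε => ε ^ (N - 1) :=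
        IsBigO.fun_sum fun g' hg' =>
          isBigO_const_order_smul (not_lt.1 (Finset.mem_filter.1 hg').2) _ _
      refine (h3.sub h4).congr_left fun ε => ?_
      have hfilter : (forestsLT d N).filter (fun g' => Forest.order g' < N - 1) =
          forestsLT d (N - 1) := by
        ext g'
        simp only [Finset.mem_filter, mem_forestsLT]
        omega
      rw [cutSeries, ← Finset.sum_filter_add_sum_filter_not (forestsLT d N)
        (fun g' => Forest.order g' < N - 1), hfilter]
      abel
    refine (h1.smul h2).congr_right fun ε => ?_
    rw [smul_eq_mul, ← pow_succ']
    congr 1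
    omega
  -- Both forest series expand σ_μ, at two points that agree up to O(ε^N) by `hshift`.
  have hmain : ∀ τ : DTree d → ℝ, (∀ h, ¬ h.order ≤ Forest.order f → τ h = 0) →
      (fun ε => ∑ g ∈ forestsLT d N, (ε ^ Forest.order g * (g.map (conv u τ)).prod) •
          normDiff σ (DTree.node μ g) x -
        ∑ g ∈ forestsLT d N, (ε ^ Forest.order g * (g.map τ).prod) •
          normDiff σ (DTree.node μ g) (x + z ε)) =O[𝓝[>] 0] fun ε => ε ^ N := by
    intro τ hτ
    have h1 := isBigO_forestSeries hN hσ μ (conv u τ) hx1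
    have h2 := isBigO_forestSeries hN hσ μ τ hxz1
    have h3 := (isBigO_sub_comp_of_bounded ((hσ μ).of_le (by exact_mod_cast hN))
      (hx1.add ((isBigO_treeSeries hσ (conv u τ) hx1).trans hid))
      (hxz1.add ((isBigO_treeSeries hσ τ hxz1).trans hid))).trans (hshift τ hτ)
    refine ((h3.sub h1).add h2).congr_left fun ε => ?_
    abel
  -- One finite index set containing the supports of all contracted coproducts that occur.
  let F : Finset (Forest d) := forestsLT d N ∪
    (forestsLT d N).biUnion fun g => (cut u g).coeff.support
  let a : Forest d → ℝ → 𝔼 := fun f ε => cutSeries u σ x μ f ε -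
    if f ∈ forestsLT d N then ε ^ Forest.order f • normDiff σ (DTree.node μ f) (x + z ε) else 0
  have hfN : f ∈ forestsLT d N := mem_forestsLT.2 hf
  -- Since `hmain` is polynomial in τ, its monomial of f can be isolated modulo O(ε^N). The trees of
  -- f have order at most |f|, so the restriction on τ does not hide this monomial.
  have hmem := coeff_mem_of_forall_sum_mem (bigOSubmodule 𝔼 (𝓝[>] (0 : ℝ)) fun ε => ε ^ N)
    (fun h : DTree d => h.order ≤ Forest.order f) F a (by
      intro τ hτ
      refine (hmain τ hτ).congr_left fun ε => ?_
      simp only [Finset.sum_apply, Pi.smul_apply, a, smul_sub, Finset.sum_sub_distrib]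
      congr 1
      · simp only [cutSeries, Finset.smul_sum]
        rw [Finset.sum_comm]
        refine Finset.sum_congr rfl fun g hg => ?_
        rw [← evalAlg_cut, evalAlg_eq_sum τ (cut u g) (F := F)]
        · simp only [smul_smul]
          rw [← Finset.sum_smul, Finset.mul_sum]
          congr 1
          refine Finset.sum_congr rfl fun g' _ => ?_
          ring
        · intro g' hg'
          exact Finset.mem_union_right _ (Finset.mem_biUnion.2
            ⟨g, hg, Finsupp.mem_support_iff.2 hg'⟩)
      · simp only [smul_ite, smul_zero]
        rw [← Finset.sum_filter]
        have hfilter : F.filter (fun g => g ∈ forestsLT d N) = forestsLT d N := by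
          ext g
          simp only [Finset.mem_filter, F, Finset.mem_union]
          tauto
        rw [hfilter]
        refine Finset.sum_congr rfl fun g _ => ?_
        rw [smul_smul, mul_comm])
    f (Finset.mem_union_left _ hfN) (fun h hh => DTree.order_le_of_mem hh)
  refine IsBigO.congr_left hmem fun ε => ?_
  simp only [a, if_pos hfN]

end CutSeries

/-! ### Remainders of coherent paths in terms of series. -/

section Remainders

variable {d k N : ℕ} {T : ℝ}

local notation "𝔼" => EuclideanSpace ℝ (Fin k)

theorem map_eq_sum_basis {M : Type*} [AddCommGroup M] [Module ℝ M] (A : ForestAlg d →ₗ[ℝ] M)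
    (a : ForestAlg d) {F : Finset (Forest d)} (h : ∀ f, a.coeff f ≠ 0 → f ∈ F) :
    A a = ∑ f ∈ F, a.coeff f • A (Forest.basis f) := by
  have e : A = linearExt fun f => A (Forest.basis f) :=
    forestAlg_hom_ext fun f => by rw [linearExt_basis]
  conv_lhs => rw [e]
  exact linearExt_eq_sum _ _ fun f hf _ => h f hf

theorem tensorPair_coproduct_eq_sum (u : Character d N) (U : Fin k → ForestAlg d) (f : Forest d)
    {F : Finset (Forest d)} (h : ∀ g, g ∉ F → coeffVec U g = 0) :
    (WithLp.toLp 2 (fun i => tensorPair u f (coproduct (U i))) : 𝔼) =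
      ∑ g ∈ F, (cut u g).coeff f • coeffVec U g := by
  ext i
  change tensorPair u f (coproduct (U i)) = _
  rw [tensorPair_eq]
  change (coeffLin f ∘ₗ slice u ∘ₗ coproduct) (U i) = _
  rw [map_eq_sum_basis _ (U i) (F := F)]
  · simp only [WithLp.ofLp_sum, Finset.sum_apply, WithLp.ofLp_smul, Pi.smul_apply, smul_eq_mul]
    refine Finset.sum_congr rfl fun g _ => ?_
    rw [mul_comm, LinearMap.comp_apply, LinearMap.comp_apply, slice_coproduct_basis]
    rfl
  · intro g hg
    by_contra hgF
    exact hg (congrArg (fun v : 𝔼 => v i) (h g hgF))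

theorem remainder_comp_eq (hN : 1 ≤ N) {σ : Fin d → 𝔼 → 𝔼} (hσ : ∀ μ, ContDiff ℝ N (σ μ))
    {Y : TreePath d k N T} (hY : Coherent σ Y) (X : CharPath d N T) (μ : Fin d) (f : Forest d)
    (hf : Forest.order f < N) {s t : Set.Icc (0 : ℝ) T} (hs : 0 < (s : ℝ)) (ht : 0 < (t : ℝ)) :
    remainder X (Y.comp (σ μ)) f s t =
      normDiff σ (DTree.node μ f) (Y.base t) - cutSeries (X s t) σ (Y.base s) μ f 1 := by
  rw [remainder, tensorPair_coproduct_eq_sum (F := forestsLT d N),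
    coeffVec_comp_of_coherent hN hσ hY ht, if_pos hf, cutSeries]
  · congr 1
    refine Finset.sum_congr rfl fun g hg => ?_
    rw [coeffVec_comp_of_coherent hN hσ hY hs, if_pos (mem_forestsLT.1 hg), one_pow, one_mul]
  · intro g hg
    rw [coeffVec_comp_of_coherent hN hσ hY hs, if_neg fun h => hg (mem_forestsLT.2 h)]

/-- Only 𝟙 and single trees occur in Y_s, and the 𝟙-coefficient of a contracted tree is its
character value. So this remainder is exactly the displacement used in the mean value estimate. -/
theorem remainder_base_eq (hN : 1 ≤ N) {σ : Fin d → 𝔼 → 𝔼} (hσ : ∀ μ, ContDiff ℝ N (σ μ))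
    {Y : TreePath d k N T} (hY : Coherent σ Y) (X : CharPath d N T)
    {s t : Set.Icc (0 : ℝ) T} (hs : 0 < (s : ℝ)) :
    remainder X Y.toAlg 0 s t = Y.base t -
      (Y.base s + treeSeries N σ (fun h => (X s t).val {h}) (Y.base s) 1) := by
  classical
  rw [remainder, tensorPair_coproduct_eq_sum
    (F := insert 0 ((DTree.upTo d (N - 1)).image fun h => ({h} : Forest d))), Finset.sum_insert,
    Finset.sum_image]
  · rw [coeff_zero_cut_zero, one_smul, treeSeries, TreePath.base, TreePath.base]
    congr 2
    refine Finset.sum_congr rfl fun h hh => ?_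
    rw [coeff_zero_cut_singleton, one_pow, one_mul,
      coeffVec_singleton_of_coherent hN hσ hY hs h (DTree.mem_upTo.1 hh)]
    rfl
  · intro h _ h' _ e
    exact Multiset.singleton_inj.1 e
  · intro h
    obtain ⟨t, -, ht⟩ := Finset.mem_image.1 h
    exact Multiset.singleton_ne_zero t ht
  · intro g hg
    refine Y.coeffVec_toAlg_eq_zero s g fun hg' => hg ?_
    rcases hg' with rfl | ⟨h, hh, rfl⟩
    · exact Finset.mem_insert_self _ _
    · exact Finset.mem_insert_of_mem (Finset.mem_image_of_mem _ (DTree.mem_upTo.2 hh))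

end Remainders

/-! ### Finiteness of the suprema and the mean value estimate. -/

section Bounds

variable {d k : ℕ}

local notation "𝔼" => EuclideanSpace ℝ (Fin k)

/-- Closed balls are compact. Boundedness is essential, as the real `sSup` of a set unbounded above
is 0. -/
theorem bddAbove_fderiv {G : 𝔼 → 𝔼} (hG : ContDiff ℝ 1 G) (x : 𝔼) (ρ c : ℝ) (hc : 0 ≤ c) :
    BddAbove {r : ℝ | ∃ a : 𝔼, ‖a‖ ≤ ρ ∧ r = ‖fderiv ℝ G (x + a)‖ * c} := by
  have hcont : Continuous fun a => fderiv ℝ G (x + a) :=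
    (hG.continuous_fderiv one_ne_zero).comp (continuous_const.add continuous_id)
  obtain ⟨C, hC⟩ := (isCompact_closedBall (0 : 𝔼) ρ).exists_bound_of_continuousOn hcont.continuousOn
  refine ⟨C * c, ?_⟩
  rintro r ⟨a, ha, rfl⟩
  exact mul_le_mul_of_nonneg_right (hC a (mem_closedBall_zero_iff.2 ha)) hc

theorem bddAbove_multiDeriv {G : 𝔼 → 𝔼} {n : ℕ} (hG : ContDiff ℝ n G) (B : Set (Forest d))
    (hB : B.Finite) (hcard : ∀ f ∈ B, Multiset.card f ≤ n) (v : DTree d → 𝔼) (x : 𝔼) (ρ : ℝ) :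
    BddAbove {r : ℝ | ∃ f ∈ B, ∃ z : 𝔼, ‖z‖ ≤ ρ ∧ r = ‖multiDeriv G (x + z) (f.map v)‖} := by
  have e : {r : ℝ | ∃ f ∈ B, ∃ z : 𝔼, ‖z‖ ≤ ρ ∧ r = ‖multiDeriv G (x + z) (f.map v)‖} =
      ⋃ f ∈ B, {r : ℝ | ∃ z : 𝔼, ‖z‖ ≤ ρ ∧ r = ‖multiDeriv G (x + z) (f.map v)‖} := by
    ext r
    simp
  rw [e, hB.bddAbove_biUnion]
  intro f hf
  have hcont : Continuous fun z => multiDeriv G (x + z) (f.map v) :=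
    (contDiff_multiDeriv_const (m := 0) hG (f.map v)
      (by simpa using hcard f hf)).continuous.comp (continuous_const.add continuous_id)
  obtain ⟨C, hC⟩ := (isCompact_closedBall (0 : 𝔼) ρ).exists_bound_of_continuousOn hcont.continuousOn
  refine ⟨C, ?_⟩
  rintro r ⟨z, hz, rfl⟩
  exact hC z (mem_closedBall_zero_iff.2 hz)

/-- A boundary forest has one tree, of order at most N - 1, more than a forest of order at most n.
The cardinality bound fits C^(n+1) regularity; the order bound gives finiteness of the boundary. -/
theorem boundary_forestsLE {N n : ℕ} {ord : LinearOrder {h : DTree d // h.order ≤ N - 1}}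
    {f : Forest d} (hf : f ∈ boundary N ord (forestsLE d N n)) :
    Multiset.card f ≤ n + 1 ∧ Forest.order f ≤ N - 1 + n := by
  obtain ⟨-, -, -, h, g, rfl, hg, -⟩ := hf
  have h1 := DTree.card_le_order g
  have h2 : Forest.order g ≤ n := hg.2
  have h3 := h.2
  rw [Multiset.card_cons, Forest.order_cons]
  omega

theorem finite_boundary_forestsLE (N n : ℕ) (ord : LinearOrder {h : DTree d // h.order ≤ N - 1}) :
    (boundary N ord (forestsLE d N n)).Finite :=
  (finite_forest_order_lt d (N - 1 + n + 1)).subset fun _ hf =>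
    Nat.lt_succ_of_le (boundary_forestsLE hf).2

theorem norm_sub_le_sSup_fderiv {G : 𝔼 → 𝔼} (hG : ContDiff ℝ 1 G) (x z y : 𝔼) {ρ c : ℝ}
    (hz : ‖z‖ ≤ ρ) (hy : ‖y - x‖ ≤ ρ) (hc : c = ‖y - (x + z)‖) :
    ‖G y - G (x + z)‖ ≤ sSup {r : ℝ | ∃ a : 𝔼, ‖a‖ ≤ ρ ∧ r = ‖fderiv ℝ G (x + a)‖ * c} := by
  have hc0 : 0 ≤ c := hc ▸ norm_nonneg _
  -- The supremum carries the factor `c`, which must be divided out to bound the derivative itself.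
  rcases hc0.eq_or_lt with h0 | hpos
  · have : y = x + z := by
      rw [← sub_eq_zero, ← norm_eq_zero, ← hc, h0]
    rw [this, sub_self, norm_zero]
    refine Real.sSup_nonneg ?_
    rintro r ⟨a, -, rfl⟩
    positivity
  · set K := sSup {r : ℝ | ∃ a : 𝔼, ‖a‖ ≤ ρ ∧ r = ‖fderiv ℝ G (x + a)‖ * c} with hK
    have hbound : ∀ w ∈ Metric.closedBall x ρ, ‖fderiv ℝ G w‖ ≤ K / c := by
      intro w hw
      rw [le_div_iff₀ hpos]
      refine le_csSup (bddAbove_fderiv hG x ρ c hc0) ⟨w - x, ?_, by rw [add_sub_cancel]⟩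
      rwa [← dist_eq_norm]
    have := (convex_closedBall x ρ).norm_image_sub_le_of_norm_fderiv_le
      (fun w _ => hG.differentiable one_ne_zero w) hbound (x := x + z) (y := y)
      (by simpa using hz) (by rwa [Metric.mem_closedBall, dist_eq_norm])
    rwa [← hc, div_mul_cancel₀ _ hpos.ne'] at this

end Bounds

/-! ### Weighted Taylor expansion along a tree series. -/

section ForestTaylor

variable {d k : ℕ}

local notation "𝔼" => EuclideanSpace ℝ (Fin k)

theorem norm_smul_normDiff_le (σ : Fin d → 𝔼 → 𝔼) (h : DTree d) (c : ℝ) (x : 𝔼) :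
    ‖c • normDiff σ h x‖ ≤ ‖c • upsilonTree σ h x‖ := by
  rw [normDiff, smul_comm, norm_smul (symInv h), Real.norm_of_nonneg (symInv_mem_Icc h).1]
  exact mul_le_of_le_one_left (norm_nonneg _) (symInv_mem_Icc h).2

theorem norm_treeSeries_one_le {N : ℕ} (σ : Fin d → 𝔼 → 𝔼) (χ : DTree d → ℝ) (x : 𝔼) :
    ‖treeSeries N σ χ x 1‖ ≤ ∑ h ∈ DTree.upTo d (N - 1), ‖χ h • upsilonTree σ h x‖ := by
  refine norm_sum_le_of_le _ fun h _ => ?_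
  rw [one_pow, one_mul]
  exact norm_smul_normDiff_le σ h _ x

theorem prod_symInv_mem_Icc (f : Forest d) : (f.map symInv).prod ∈ Set.Icc (0 : ℝ) 1 := by
  induction f using Multiset.induction_on with
  | empty => simp
  | cons t f ih =>
    rw [Multiset.map_cons, Multiset.prod_cons]
    have h := symInv_mem_Icc t
    exact ⟨mul_nonneg h.1 ih.1, mul_le_one₀ h.2 ih.1 ih.2⟩

/-- Taylor expansion along a tree series, with the error controlled by the derivatives indexed by
the boundary of the set of forests of order at most `n`. -/
theorem exists_forest_taylor {N n : ℕ} (ord : LinearOrder {h : DTree d // h.order ≤ N - 1})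
    (σ : Fin d → 𝔼 → 𝔼) (χ : DTree d → ℝ) (x : 𝔼) {G : 𝔼 → 𝔼} (hG : ContDiff ℝ (n + 1 : ℕ) G) :
    ∃ q ∈ polyLE 𝔼 n, ∀ ε ∈ Set.Icc (0 : ℝ) 1,
      ‖G (x + treeSeries N σ χ x ε) - q ε‖ ≤ (n + 2 : ℝ) ^ (DTree.upTo d (N - 1)).card *
        sSup {r : ℝ | ∃ f ∈ boundary N ord (forestsLE d N n), ∃ z : 𝔼,
          ‖z‖ ≤ ∑ h ∈ DTree.upTo d (N - 1), ‖χ h • upsilonTree σ h x‖ ∧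
          r = ‖multiDeriv G (x + z) (f.map fun h => χ h • upsilonTree σ h x)‖} * ε ^ (n + 1) := by
  let ι := {h : DTree d // h.order ≤ N - 1}
  let _ := ord
  have : Fintype ι := (DTree.finite_order_le d (N - 1)).fintype
  -- Larger trees are expanded first, so the distinguished element of each error multiset is its
  -- minimal tree, as in the definition of the boundary.
  let L : List ι := Finset.univ.sort (· ≥ ·)
  let ω : ι → ℕ := fun h => h.1.order
  let w : ι → 𝔼 := fun h => χ h.1 • normDiff σ h.1 x
  have hsum : ∀ {M : Type} [AddCommMonoid M] (F : DTree d → M),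
      (L.map fun h => F h.1).sum = ∑ h ∈ DTree.upTo d (N - 1), F h := by
    intro M _ F
    rw [← Multiset.sum_coe, ← Multiset.map_coe, Finset.sort_eq]
    exact (Finset.sum_subtype (DTree.upTo d (N - 1)) (fun h => DTree.mem_upTo) F).symm
  have hlen : L.length = (DTree.upTo d (N - 1)).card := by
    rw [Finset.length_sort, Finset.card_univ]
    exact Fintype.card_of_subtype _ fun h => DTree.mem_upTo
  set S := {r : ℝ | ∃ f ∈ boundary N ord (forestsLE d N n), ∃ z : 𝔼,
          ‖z‖ ≤ ∑ h ∈ DTree.upTo d (N - 1), ‖χ h • upsilonTree σ h x‖ ∧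
          r = ‖multiDeriv G (x + z) (f.map fun h => χ h • upsilonTree σ h x)‖} with hS
  have hS0 : 0 ≤ sSup S := by
    refine Real.sSup_nonneg ?_
    rintro r ⟨f, -, z, -, rfl⟩
    positivity
  have hbdd : BddAbove S := bddAbove_multiDeriv hG _ (finite_boundary_forestsLE N n ord)
    (fun f hf => (boundary_forestsLE hf).1) _ x _
  obtain ⟨q, hq, hb⟩ := exists_weighted_taylor (ω := ω) (fun h => one_le_order h.1) w x
    (r := (· ≥ ·)) (ρ := ∑ h ∈ DTree.upTo d (N - 1), ‖χ h • upsilonTree σ h x‖) hS0 L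
    (Finset.pairwise_sort _ _) (by
      rw [hsum fun h => ‖χ h • normDiff σ h x‖]
      exact Finset.sum_le_sum fun h _ => norm_smul_normDiff_le σ h _ x) n G hG (by
      intro i _ g hg hgn hgn' z hz
      have hmapω : (g.map ω).sum = Forest.order (g.map Subtype.val) := by
        rw [Forest.order, Multiset.map_map]; rfl
      have hmem : i.1 ::ₘ g.map Subtype.val ∈ boundary N ord (forestsLE d N n) := by
        have hle : ∀ h ∈ g.map Subtype.val, h.order ≤ N := by
          intro h hh
          obtain ⟨j, -, rfl⟩ := Multiset.mem_map.1 hh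
          exact j.2.trans (Nat.sub_le _ _)
        refine ⟨?_, ?_, Multiset.cons_ne_zero, i, g.map Subtype.val, rfl,
          ⟨hle, hmapω ▸ hgn⟩, ?_⟩
        · intro h hh
          rcases Multiset.mem_cons.1 hh with rfl | hh
          · exact i.2.trans (Nat.sub_le _ _)
          · exact hle h hh
        · intro h
          have h1 := h.2
          rw [Forest.order_cons, ← hmapω] at h1
          change n < _ + i.1.order at hgn'
          omega
        · intro h' hh'
          rcases Multiset.mem_cons.1 hh' with e | hh
          · rw [Subtype.ext e]
          · obtain ⟨j, hj, e⟩ := Multiset.mem_map.1 hh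
            rw [← Subtype.ext e]
            rcases (hg j hj).2 with rfl | h2
            · exact le_rfl
            · exact h2
      have hcard := (boundary_forestsLE hmem).1
      -- The inverse symmetry factors come out by multilinearity and are then discarded, their
      -- product being at most 1.
      have e : (i ::ₘ g).map w = (i.1 ::ₘ g.map Subtype.val).map
          fun h => symInv h • χ h • upsilonTree σ h x := by
        rw [← Multiset.map_cons, Multiset.map_map]
        refine Multiset.map_congr rfl fun h _ => ?_
        change χ h.1 • symInv h.1 • _ = _
        rw [smul_comm]
        rfl
      rw [e, multiDeriv_map_smul _ symInv _ (hG.of_le (by exact_mod_cast hcard)), norm_smul]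
      have hp := prod_symInv_mem_Icc (i.1 ::ₘ g.map Subtype.val)
      rw [Real.norm_of_nonneg hp.1]
      exact (mul_le_of_le_one_left (norm_nonneg _) hp.2).trans
        (le_csSup hbdd ⟨_, hmem, z, hz, rfl⟩))
  refine ⟨q, hq, fun ε hε => ?_⟩
  have := hb ε hε
  rw [hlen] at this
  convert this using 5
  rw [treeSeries, ← hsum fun h => (ε ^ h.order * χ h) • normDiff σ h x]
  simp only [mul_smul]
  rfl

end ForestTaylor

end BranchedRough


/-! ### The remainder estimate. -/

open BranchedRough Filter Topology Asymptotics in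
theorem corollary3p7 (d k : ℕ) (α : ℝ) (hα0 : 0 < α) (hα1 : α < 1)
    (N : ℕ) (hN : (N : ℝ) * α ≤ 1) (hN' : 1 < ((N : ℝ) + 1) * α) :
    ∃ C : ℝ, 0 < C ∧
      ∀ (ord : LinearOrder {h : BranchedRough.DTree d // h.order ≤ N - 1})
        (σ : Fin d → EuclideanSpace ℝ (Fin k) → EuclideanSpace ℝ (Fin k)),
        (∀ μ, ContDiff ℝ N (σ μ)) →
      ∀ (T : ℝ) (X : BranchedRough.CharPath d N T) (Y : BranchedRough.TreePath d k N T),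
        BranchedRough.Coherent σ Y →
      ∀ (μ : Fin d), ∀ f ∈ BranchedRough.forestsLE d N (N - 1),
      ∀ s t : Set.Icc (0 : ℝ) T, 0 < (s : ℝ) → 0 < (t : ℝ) →
        ‖BranchedRough.remainder X (Y.comp (σ μ)) f s t‖ ≤
          C * (sSup {r : ℝ | ∃ a : EuclideanSpace ℝ (Fin k),
                  ‖a‖ ≤ BranchedRough.expansionBound σ X Y s t + ‖Y.base t - Y.base s‖ ∧
                  r = ‖fderiv ℝ (BranchedRough.upsilon σ μ f) (Y.base s + a)‖ *
                    ‖BranchedRough.remainder X Y.toAlg 0 s t‖} +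
               sSup {r : ℝ | ∃ f' ∈ BranchedRough.boundary N ord
                    (BranchedRough.forestsLE d N (N - BranchedRough.Forest.order f - 1)),
                  ∃ z : EuclideanSpace ℝ (Fin k),
                  ‖z‖ ≤ BranchedRough.expansionBound σ X Y s t ∧
                  r = ‖BranchedRough.multiDeriv (BranchedRough.upsilon σ μ f) (Y.base s + z)
                    (f'.map (fun h => (X s t).val {h} •
                      BranchedRough.upsilonTree σ h (Y.base s)))‖}) := by
  have hN1 : 1 ≤ N := by
    by_contra h
    have : N = 0 := by omega
    subst this
    norm_num at hN'
    linarith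
  -- Depends only on d and N, and N is determined by α.
  set M : ℝ := (N + 2 : ℝ) ^ (DTree.upTo d (N - 1)).card with hM
  have hM0 : 0 < M := by positivity
  refine ⟨1 + M, by positivity, ?_⟩
  intro ord σ hσ T X Y hY μ f hf s t hs ht
  have hfN : Forest.order f < N := by have := hf.2; omega
  set n := N - Forest.order f - 1 with hn
  set u := X s t
  set x := Y.base s with hx
  set y := Y.base t
  set G := upsilon σ μ f with hGdef
  set χ : DTree d → ℝ := fun h => u.val {h} with hχ
  set S₁ := {r : ℝ | ∃ a : EuclideanSpace ℝ (Fin k),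
    ‖a‖ ≤ expansionBound σ X Y s t + ‖y - x‖ ∧
    r = ‖fderiv ℝ G (x + a)‖ * ‖remainder X Y.toAlg 0 s t‖} with hS₁
  -- [f]_μ has |f| + 1 nodes, which leaves N - |f| = n + 1 derivatives, just what an expansion up to
  -- order n needs.
  have hG : ContDiff ℝ (n + 1 : ℕ) G := by
    refine (contDiff_upsilonTree hσ (DTree.node μ f) ?_).of_le ?_
    · rw [DTree.order_node]; omega
    · rw [DTree.order_node]; norm_cast; omega
  obtain ⟨q, hq, hbound⟩ := exists_forest_taylor (N := N) (n := n) ord σ χ x hG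
  change ∀ ε ∈ Set.Icc (0 : ℝ) 1, _ ≤ _ * sSup {r : ℝ | ∃ f' ∈ boundary N ord (forestsLE d N n),
    ∃ z : EuclideanSpace ℝ (Fin k), ‖z‖ ≤ expansionBound σ X Y s t ∧
    r = ‖multiDeriv G (x + z) (f'.map (fun h => u.val {h} • upsilonTree σ h x))‖} * _ at hbound
  set K₂ := sSup {r : ℝ | ∃ f' ∈ boundary N ord (forestsLE d N n),
    ∃ z : EuclideanSpace ℝ (Fin k), ‖z‖ ≤ expansionBound σ X Y s t ∧
    r = ‖multiDeriv G (x + z) (f'.map (fun h => u.val {h} • upsilonTree σ h x))‖} with hK₂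
  set θ := symInv (DTree.node μ f)
  have hθ : θ ∈ Set.Icc (0 : ℝ) 1 := symInv_mem_Icc _
  have hnorm : ∀ z, normDiff σ (DTree.node μ f) z = θ • G z := fun z => rfl
  have hK₁0 : 0 ≤ sSup S₁ := by
    refine Real.sSup_nonneg ?_
    rintro r ⟨a, -, rfl⟩
    positivity
  have hK₂0 : 0 ≤ K₂ := by
    refine Real.sSup_nonneg ?_
    rintro r ⟨f', -, z, -, rfl⟩
    positivity
  -- Both c(ε) and ε^|f| θ q(ε) have degree at most N - 1 and approximate the same function up to
  -- O(ε^N), so they coincide; evaluate at ε = 1.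
  have hcut : cutSeries u σ x μ f 1 = θ • q 1 := by
    have hpoly : (cutSeries u σ x μ f - fun ε => ε ^ Forest.order f • θ • q ε) ∈
        polyLE (EuclideanSpace ℝ (Fin k)) (N - 1) := by
      refine Submodule.sub_mem _ (sum_mem_polyLE _ _ fun g hg => ?_)
        (pow_smul_mem_polyLE ((polyLE _ n).smul_mem θ hq) (by omega))
      simp only [mul_smul]
      exact monomial_mem_polyLE (by have := mem_forestsLT.1 hg; omega) _
    have hO : (cutSeries u σ x μ f - fun ε => ε ^ Forest.order f • θ • q ε) =O[𝓝[>] 0]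
        fun ε => ε ^ (N - 1 + 1) := by
      have h1 := isBigO_cutSeries_sub hN1 hσ u x μ f hfN
      have h2 : (fun ε => G (x + treeSeries N σ χ x ε) - q ε) =O[𝓝[>] 0]
          fun ε => ε ^ (n + 1) := by
        refine IsBigO.of_bound ((n + 2 : ℝ) ^ (DTree.upTo d (N - 1)).card * K₂) ?_
        filter_upwards [Ioo_mem_nhdsGT (zero_lt_one' ℝ)] with ε hε
        rw [norm_pow, Real.norm_of_nonneg hε.1.le]
        exact hbound ε ⟨hε.1.le, hε.2.le⟩
      have h3 := (isBigO_refl (fun ε : ℝ => ε ^ Forest.order f) (𝓝[>] 0)).smul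
        (h2.const_smul_left θ)
      have hexp : ∀ ε : ℝ, ε ^ Forest.order f • ε ^ (n + 1) = ε ^ N := fun ε => by
        rw [smul_eq_mul, ← pow_add]
        congr 1
        omega
      simp only [hexp] at h3
      rw [Nat.sub_add_cancel hN1]
      refine (h1.add h3).congr_left fun ε => ?_
      rw [hnorm]
      simp only [Pi.sub_apply, Pi.smul_apply, smul_sub]
      abel
    have h0 := congrFun (eq_zero_of_mem_polyLE_of_isBigO hpoly hO) 1
    simpa [sub_eq_zero] using h0
  have hrem : remainder X (Y.comp (σ μ)) f s t = θ • (G y - q 1) := by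
    rw [remainder_comp_eq hN1 hσ hY X μ f hfN hs ht, hcut, hnorm, smul_sub]
  have hz : ‖treeSeries N σ χ x 1‖ ≤ expansionBound σ X Y s t := norm_treeSeries_one_le σ χ x
  have hfirst : ‖G y - G (x + treeSeries N σ χ x 1)‖ ≤ sSup S₁ :=
    norm_sub_le_sSup_fderiv (hG.of_le (by norm_cast; omega)) x _ y
      (by linarith [norm_nonneg (y - x)]) (by linarith [norm_nonneg (treeSeries N σ χ x 1)])
      (by rw [remainder_base_eq hN1 hσ hY X hs])
  have hsecond : ‖G (x + treeSeries N σ χ x 1) - q 1‖ ≤ M * K₂ := by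
    have := hbound 1 ⟨zero_le_one, le_rfl⟩
    rw [one_pow, mul_one] at this
    refine this.trans (mul_le_mul_of_nonneg_right ?_ hK₂0)
    rw [hM]
    gcongr
    omega
  rw [hrem, norm_smul, Real.norm_of_nonneg hθ.1]
  refine (mul_le_of_le_one_left (norm_nonneg _) hθ.2).trans ?_
  refine (norm_sub_le_norm_sub_add_norm_sub _ (G (x + treeSeries N σ χ x 1)) _).trans ?_
  nlinarith [mul_nonneg hM0.le hK₁0]

end
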